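/- Let $n\ge 1$. For $H\colon\mathbb R^{n+1}\to\mathbb R$, an $H$-bubble is a $C^\infty$ embedded hypersurface of $\mathbb R^{n+1}$, diffeomorphic to $\mathbb S^n$, whose mean curvature (the arithmetic mean of the $n$ principal curvatures, for a suitable smooth unit normal; for $H>0$ this is the outward one, so that a round sphere of radius $r$ has mean curvature $1/r$) equals $H(q)$ at each of its points $q$. Let $h\colon\mathbb R\to\mathbb R$ be even, $2\pi$-periodic and of class $C^\infty$, with $h''(0)=h''''(0)=h''(\pi)=0$. For $\varepsilon\in\mathbb R$ put $g_\varepsilon=1+\varepsilon h$, $\gamma_\varepsilon(t)=(g_\varepsilon(t)\sin t,\ g_\varepsilon(\pi)+g_\varepsilon(t)\cos t)$, $$K_1=\dots=K_{n-1}=\frac{g_\varepsilon-\frac{\cos t}{\sin t}g_\varepsilon'}{g_\varepsilon\sqrt{g_\varepsilon^2+(g_\varepsilon')^2}},\qquad K_n=\frac{g_\varepsilon^2+2(g_\varepsilon')^2-g_\varepsilon g_\varepsilon''}{[g_\varepsilon^2+(g_\varepsilon')^2]^{3/2}}$$ (functions of $t\in[0,\pi]$, extended by continuity at $t=0,\pi$).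 For $|\varepsilon|$ small, $|\gamma_\varepsilon|$ is a bijection from $[0,\pi]$ onto $[0,g_\varepsilon(0)+g_\varepsilon(\pi)]$; let $|\gamma_\varepsilon|^{-1}$ be its inverse. Put $\rho_\varepsilon=\dfrac{g_\varepsilon(0)+g_\varepsilon(\pi)}{g_\varepsilon(0)}$ and $$H_\varepsilon(q)=\begin{cases}\dfrac{g_\varepsilon(0)}{n}\displaystyle\sum_{i=1}^n K_i\bigl(|\gamma_\varepsilon|^{-1}(g_\varepsilon(0)\,|q|)\bigr)&\text{if }|q|\le\rho_\varepsilon,\\[1ex]1&\text{if }|q|>\rho_\varepsilon,\end{cases}\qquad q\in\mathbb R^{n+1}.$$ Then there is $\varepsilon_0>0$ such that, for every sequence $(\varepsilon_j)_{j\in\mathbb N}$ of real numbers with $|\varepsilon_j|<\varepsilon_0$ for all $j$ and every sequence $(p_j)_{j\in\mathbb N}$ of points of $\mathbb R^{n+1}$ with $$|p_i-p_j|\ \ge\ \rho_{\varepsilon_i}+\rho_{\varepsilon_j}+2\qquad(i\ne j),$$ the function $H$ given by $H(q)=H_{\varepsilon_j}(q-p_j)$ if $|q-p_j|\le\rho_{\varepsilon_j}$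 for some $j$, and $H(q)=1$ otherwise, is well defined and satisfies: 1. $H\in C^1(\mathbb R^{n+1})$; 2. there are $C_1,C_2>0$ with $C_1\le H(q)\le C_2$ for all $q\in\mathbb R^{n+1}$; 3. through every $q\in\mathbb R^{n+1}$ there passes an $H$-bubble; 4. if all the $\varepsilon_j$ are equal and $v\in\mathbb R^{n+1}$ is such that $\{p_j\}+v=\{p_j\}$, then $H(q+v)=H(q)$ for all $q$ (so if the set of centers is periodic in $n+1$ linearly independent directions, so is $H$); 5. if $\varepsilon_j\to0$ as $j\to\infty$, then $H(q)\to1$ as $|q|\to\infty$; 6. if $h$ vanishes in neighbourhoods of $0$ and of $\pi$, then $H\in C^\infty(\mathbb R^{n+1})$. -/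

import Mathlib

open scoped Manifold ContDiff

noncomputable section

namespace HBubble

/-! ### Bubbles in `ℝ^{n+1}` -/

/-- The unit sphere `𝕊ⁿ` of `ℝ^{n+1}`, with Mathlib's manifold structure. -/
abbrev UnitSphere (n : ℕ) : Type :=
  Metric.sphere (0 : EuclideanSpace ℝ (Fin (n + 1))) 1

/-- `Φ : 𝕊ⁿ → ℝ^{n+1}` parametrizes a `C^∞` embedded hypersurface diffeomorphic to `𝕊ⁿ`: it is
smooth, injective and has injective differential everywhere (as `𝕊ⁿ` is compact, such a map is
automatically a topological embedding). -/
structure IsSmoothEmbeddedSphere {n : ℕ}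
    (Φ : UnitSphere n → EuclideanSpace ℝ (Fin (n + 1))) : Prop where
  smooth : ContMDiff (𝓡 n) 𝓘(ℝ, EuclideanSpace ℝ (Fin (n + 1))) ∞ Φ
  injective : Function.Injective Φ
  immersion : ∀ x, Function.Injective (mvfderiv (𝓡 n) Φ x)

/-- `N` is a smooth unit normal field along `Φ`. -/
structure IsUnitNormal {n : ℕ} (Φ N : UnitSphere n → EuclideanSpace ℝ (Fin (n + 1))) : Prop where
  smooth : ContMDiff (𝓡 n) 𝓘(ℝ, EuclideanSpace ℝ (Fin (n + 1))) ∞ N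
  norm_eq_one : ∀ x, ‖N x‖ = 1
  normal : ∀ (x : UnitSphere n) (v : TangentSpace (𝓡 n) x),
    inner ℝ (N x) (mvfderiv (𝓡 n) Φ x v) = 0

/-- The hypersurface parametrized by `Φ` has mean curvature `m` at `Φ x`, with respect to the unit
normal `N`. The shape operator is `w ↦ ∂N/∂w` on the tangent space of the hypersurface; `L` is its
expression on `T_x 𝕊ⁿ` through the isomorphism `dΦ_x`, i.e. `dN_x = dΦ_x ∘ L`. The mean curvature is
the arithmetic mean of the principal curvatures, i.e. `(1/n) tr L`. With the outward normal, a round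
sphere of radius `r` has mean curvature `1/r`. -/
def HasMeanCurvatureAt {n : ℕ} (Φ N : UnitSphere n → EuclideanSpace ℝ (Fin (n + 1)))
    (x : UnitSphere n) (m : ℝ) : Prop :=
  ∃ L : TangentSpace (𝓡 n) x →ₗ[ℝ] TangentSpace (𝓡 n) x,
    (∀ v, mvfderiv (𝓡 n) N x v = mvfderiv (𝓡 n) Φ x (L v)) ∧
    m = (n : ℝ)⁻¹ * LinearMap.trace ℝ (TangentSpace (𝓡 n) x) L

/-- `S` is an `H`-bubble: an embedded hypersurface diffeomorphic to `𝕊ⁿ` whose mean curvature at each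
of its points `q` is `H q`, for a suitable choice of the smooth unit normal. (If `H > 0`, this normal
is necessarily the outward one: at a point of `S` farthest from the origin, the mean curvature with
respect to the inward normal is negative.) -/
def IsBubble {n : ℕ} (H : EuclideanSpace ℝ (Fin (n + 1)) → ℝ)
    (S : Set (EuclideanSpace ℝ (Fin (n + 1)))) : Prop :=
  ∃ Φ N : UnitSphere n → EuclideanSpace ℝ (Fin (n + 1)),
    IsSmoothEmbeddedSphere Φ ∧ Set.range Φ = S ∧ IsUnitNormal Φ N ∧
      ∀ x, HasMeanCurvatureAt Φ N x (H (Φ x))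

/-! ### The profile and its curvatures -/

/-- `g_ε = 1 + ε h`. -/
def profile (h : ℝ → ℝ) (ε : ℝ) (t : ℝ) : ℝ := 1 + ε * h t

/-- The profile curve `γ(t) = (g(t) sin t, g(π) + g(t) cos t)`. -/
def profileCurve (g : ℝ → ℝ) (t : ℝ) : EuclideanSpace ℝ (Fin 2) :=
  !₂[g t * Real.sin t, g Real.pi + g t * Real.cos t]

/-- The inverse `|γ|⁻¹` of the function `|γ| : [0, π] → [0, g(0) + g(π)]`. -/
def profileAngle (g : ℝ → ℝ) : ℝ → ℝ :=
  Function.invFunOn (fun t => ‖profileCurve g t‖) (Set.Icc 0 Real.pi)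

/-- The principal curvatures `K₁ = ⋯ = K_{n-1}` and `K_n` (the last index of `Fin n`) of the
hypersurface of revolution with polar profile `g`, at polar angle `t`. At `t = 0` and `t = π`, Lean's
convention `x / 0 = 0` makes the term `(cos t / sin t) g'(t)` vanish, which is its limit there when
`g''(0) = g''(π) = 0` (and `g` is even and `2π`-periodic). -/
def principalCurvature (n : ℕ) (g : ℝ → ℝ) (i : Fin n) (t : ℝ) : ℝ :=
  if (i : ℕ) + 1 = n then
    (g t ^ 2 + 2 * deriv g t ^ 2 - g t * deriv (deriv g) t) /
      Real.sqrt (g t ^ 2 + deriv g t ^ 2) ^ 3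
  else
    (g t - Real.cos t / Real.sin t * deriv g t) /
      (g t * Real.sqrt (g t ^ 2 + deriv g t ^ 2))

/-! ### The blocks and their gluing -/

/-- The radius `ρ_ε = (g_ε(0) + g_ε(π)) / g_ε(0)` of the block: the largest distance from the origin
on the hypersurface with profile curve `γ_ε`, rescaled by the factor `1 / g_ε(0)`. -/
def blockRadius (h : ℝ → ℝ) (ε : ℝ) : ℝ :=
  (profile h ε 0 + profile h ε Real.pi) / profile h ε 0

/-- The block `H_ε`: the mean curvature, as a function of the distance from the origin, of the
hypersurface with profile curve `γ_ε` rescaled by the factor `1 / g_ε(0)`, and `1` outside the ball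
of radius `ρ_ε`. -/
def block (n : ℕ) (h : ℝ → ℝ) (ε : ℝ) (q : EuclideanSpace ℝ (Fin (n + 1))) : ℝ :=
  if ‖q‖ ≤ blockRadius h ε then
    profile h ε 0 / n *
      ∑ i : Fin n, principalCurvature n (profile h ε) i
        (profileAngle (profile h ε) (profile h ε 0 * ‖q‖))
  else 1

open Classical in
/-- The gluing of the blocks `H_{ε_j}(· - p_j)`, with value `1` elsewhere. (When the balls of centers
`p_j` and radii `ρ_{ε_j}` are pairwise disjoint, at most one `j` qualifies, so there is no actual
choice.) -/
def glued (n : ℕ) (h : ℝ → ℝ) (ε : ℕ → ℝ) (p : ℕ → EuclideanSpace ℝ (Fin (n + 1)))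
    (q : EuclideanSpace ℝ (Fin (n + 1))) : ℝ :=
  if hq : ∃ j, ‖q - p j‖ ≤ blockRadius h (ε j) then
    block n h (ε hq.choose) (q - p hq.choose)
  else 1

end HBubble

end

/-! Translate the surface of revolution with polar profile `g_ε` along its axis so that its south
pole (`t = π`) is the origin. For the round sphere the squared distance from that pole is `2 + 2 cos
t`, strictly monotone in `cos t`, and this persists for small `ε`. The mean curvature depends on `t`
alone, so it is a function of the distance from the origin: after rescaling, this is the block.
Since the block is radial, every copy of the surface under an orthogonal map is again a bubble, and
these copies sweep out the whole ball of radius `ρ_ε`. Away from the balls the prescribed curvature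
is 1 and unit spheres are bubbles; the separation of the balls leaves room for one through every
outer point (`exists_center`, a connectedness argument).

Regularity comes from using `u = cos t` as the variable. Smooth even `2π`-periodic functions are
smooth in `u` up to `u = ±1` (`IsSmoothEvenPeriodic.contDiffOn_comp_arccos`). The squared pole
distance has positive `u`-derivative on all of `[-1, 1]`, whereas its `t`-derivative vanishes at the
poles; it therefore has a smooth inverse on a closed interval (`exists_contDiffOn_inverse_Icc`).
Inside its ball the block is thus a smooth function of `‖q‖²`, with no singularity at the centre. At
the outer radius, `u = 1`, the conditions `h''(0) = h''''(0) = 0` say that the first two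
`u`-derivatives of the profile vanish; the rescaled mean curvature is then 1 with zero derivative
(`hasDerivWithinAt_scaledMeanCurvature_one`), and extension by 1 is `C¹`.

The curvature of the surface is computed without charts in `isBubble_range_revolutionMap`, from maps
`a(⟨x,e⟩) x + b(⟨x,e⟩) e` of the sphere. All smallness requirements are strict inequalities true at
`ε = 0`, so compactness of `[-1, 1]` yields `ε₀` (`eventually_isAdmissible`). -/

namespace HBubble

open Set Filter Topology

/-! ### Hadamard's division lemma -/

/-- Differentiation under the integral sign brings out a factor `u`. The weight `u ^ m`, with `m`
and `f` universally quantified in the induction, absorbs it. -/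
theorem contDiff_nat_integral_pow_mul (k : ℕ) : ∀ (f : ℝ → ℝ), ContDiff ℝ k f → ∀ m : ℕ,
    ContDiff ℝ k (fun x => ∫ u in (0 : ℝ)..1, u ^ m * f (u * x)) := by
  induction k with
  | zero =>
    intro f hf m
    have hf' : Continuous f := hf.continuous
    refine contDiff_zero.2 ?_
    apply intervalIntegral.continuous_parametric_intervalIntegral_of_continuous'
    fun_prop
  | succ k ih =>
    intro f hf m
    have hcast : ((k + 1 : ℕ) : WithTop ℕ∞) = (k : WithTop ℕ∞) + 1 := by push_cast; rfl
    rw [hcast] at hf ⊢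
    have hf' : ContDiff ℝ k (deriv f) := (contDiff_succ_iff_deriv.1 hf).2.2
    have hdf : Differentiable ℝ f := (contDiff_succ_iff_deriv.1 hf).1
    have hcf : Continuous f := hf.continuous
    have hcf' : Continuous (deriv f) := hf'.continuous
    have key : ∀ x, HasDerivAt (fun x => ∫ u in (0 : ℝ)..1, u ^ m * f (u * x))
        (∫ u in (0 : ℝ)..1, u ^ (m + 1) * deriv f (u * x)) x := by
      intro x
      obtain ⟨C, hC⟩ := (isCompact_Icc (a := -(|x| + 1)) (b := |x| + 1)).exists_bound_of_continuousOn
        hcf'.continuousOn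
      refine (intervalIntegral.hasDerivAt_integral_of_dominated_loc_of_deriv_le
        (bound := fun _ => C) (s := Metric.ball x 1)
        (F' := fun x u => u ^ (m + 1) * deriv f (u * x)) (Metric.ball_mem_nhds x one_pos)
        ?_ ?_ ?_ ?_ ?_ ?_).2
      · exact Eventually.of_forall fun y => Continuous.aestronglyMeasurable (by fun_prop)
      · exact Continuous.intervalIntegrable (by fun_prop) _ _
      · exact Continuous.aestronglyMeasurable (by fun_prop)
      · refine Eventually.of_forall fun u hu y hy => ?_
        rw [uIoc_of_le zero_le_one] at hu
        have hy' : |y| ≤ |x| + 1 := by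
          have := Metric.mem_ball.1 hy
          rw [Real.dist_eq] at this
          have := abs_sub_abs_le_abs_sub y x
          linarith
        have huy : |u * y| ≤ |x| + 1 := by
          rw [abs_mul, abs_of_pos hu.1]
          have := mul_le_mul hu.2 hy' (abs_nonneg y) zero_le_one
          linarith
        have h1 := hC (u * y) (abs_le.1 huy)
        rw [norm_mul, norm_pow, Real.norm_of_nonneg hu.1.le]
        have h2 : u ^ (m + 1) ≤ 1 := pow_le_one₀ hu.1.le hu.2
        have h3 := mul_le_mul h2 h1 (norm_nonneg _) zero_le_one
        linarith
      · simp
      · refine Eventually.of_forall fun u _ y _ => ?_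
        have h1 : HasDerivAt (fun y => u * y) u y := by
          simpa using (hasDerivAt_id y).const_mul u
        have h2 : HasDerivAt (fun y => f (u * y)) (deriv f (u * y) * u) y :=
          (hdf (u * y)).hasDerivAt.comp y h1
        have h3 : u ^ m * (deriv f (u * y) * u) = u ^ (m + 1) * deriv f (u * y) := by ring
        exact (h2.const_mul (u ^ m)).congr_deriv h3
    rw [contDiff_succ_iff_deriv]
    refine ⟨fun x => (key x).differentiableAt, by simp, ?_⟩
    rw [show deriv _ = _ from funext fun x => (key x).deriv]
    exact ih _ hf' (m + 1)

/-- **Hadamard's lemma**: a smooth function vanishing at `a` is divisible by `t - a`. -/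
theorem exists_contDiff_eq_sub_mul {f : ℝ → ℝ} (hf : ContDiff ℝ ∞ f) {a : ℝ} (ha : f a = 0) :
    ∃ m : ℝ → ℝ, ContDiff ℝ ∞ m ∧ ∀ t, f t = (t - a) * m t := by
  have hdf : ContDiff ℝ ∞ (deriv f) := (contDiff_infty_iff_deriv.1 hf).2
  refine ⟨fun t => ∫ u in (0 : ℝ)..1, deriv f (a + u * (t - a)), ?_, fun t => ?_⟩
  · have h1 : ContDiff ℝ ∞ (fun x => ∫ u in (0 : ℝ)..1, u ^ 0 * deriv f (a + u * x)) := by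
      refine contDiff_infty.2 fun k => contDiff_nat_integral_pow_mul k (fun y => deriv f (a + y)) ?_ 0
      exact (hdf.comp (contDiff_const.add contDiff_id)).of_le (by exact_mod_cast le_top)
    have h2 : ContDiff ℝ ∞ (fun t : ℝ => t - a) := contDiff_id.sub contDiff_const
    simpa [Function.comp_def] using h1.comp h2
  · have h1 : ∀ u ∈ uIcc (0 : ℝ) 1,
        HasDerivAt (fun u => f (a + u * (t - a))) (deriv f (a + u * (t - a)) * (t - a)) u := by
      intro u _
      have h2 : HasDerivAt (fun u => a + u * (t - a)) (t - a) u := by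
        simpa using ((hasDerivAt_id u).mul_const (t - a)).const_add a
      exact ((hf.differentiable (by simp)) (a + u * (t - a))).hasDerivAt.comp u h2
    have hc : Continuous (deriv f) := hdf.continuous
    have h3 := intervalIntegral.integral_eq_sub_of_hasDerivAt h1
      (Continuous.intervalIntegrable (by fun_prop) _ _)
    rw [intervalIntegral.integral_mul_const] at h3
    simp [ha] at h3
    rw [← h3]; ring

/-! ### Even periodic functions as functions of the cosine -/

/-- Smooth even `2π`-periodic functions. -/
structure IsSmoothEvenPeriodic (g : ℝ → ℝ) : Prop where
  smooth : ContDiff ℝ ∞ g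
  periodic : Function.Periodic g (2 * Real.pi)
  even : Function.Even g

theorem _root_.Function.Even.deriv_neg {g : ℝ → ℝ} (hg : Function.Even g) (t : ℝ) :
    deriv g (-t) = -deriv g t := by
  have h := deriv_comp_neg g t
  rw [show (fun x => g (-x)) = g from funext hg] at h
  linarith

theorem _root_.Function.Periodic.deriv_periodic {g : ℝ → ℝ} {c : ℝ} (hg : Function.Periodic g c) :
    Function.Periodic (deriv g) c := fun t => by
  rw [← deriv_comp_add_const, show (fun x => g (x + c)) = g from funext hg]

theorem IsSmoothEvenPeriodic.deriv_eq_zero {g : ℝ → ℝ} (hg : IsSmoothEvenPeriodic g) {t : ℝ}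
    (ht : Real.sin t = 0) : deriv g t = 0 := by
  obtain ⟨k, rfl⟩ := Real.sin_eq_zero_iff.1 ht
  have h1 := hg.periodic.deriv_periodic.sub_int_mul_eq (x := k * Real.pi) k
  have h2 := hg.even.deriv_neg (k * Real.pi)
  rw [show (k : ℝ) * Real.pi - k * (2 * Real.pi) = -(k * Real.pi) by ring] at h1
  linarith

/-- The derivative of `g` with respect to the cosine. -/
theorem IsSmoothEvenPeriodic.exists_deriv_eq {g : ℝ → ℝ} (hg : IsSmoothEvenPeriodic g) :
    ∃ k, IsSmoothEvenPeriodic k ∧ ∀ t, deriv g t = -(Real.sin t * k t) := by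
  classical
  have hdg : ContDiff ℝ ∞ (deriv g) := (contDiff_infty_iff_deriv.1 hg.smooth).2
  -- The value at zeros of the sine is the limit of the quotient by l'Hôpital. Near such a zero `a`,
  -- Hadamard's lemma divides both `deriv g` and `sin` by `t - a`, leaving a smooth quotient with
  -- nonvanishing denominator.
  let k : ℝ → ℝ := fun t =>
    if Real.sin t = 0 then -(deriv (deriv g) t / Real.cos t) else -(deriv g t / Real.sin t)
  refine ⟨k, ⟨?_, ?_, ?_⟩, ?_⟩
  · refine contDiff_iff_contDiffAt.2 fun a => ?_
    by_cases ha : Real.sin a = 0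
    · obtain ⟨m, hm, hgm⟩ := exists_contDiff_eq_sub_mul hdg (hg.deriv_eq_zero ha)
      obtain ⟨s, hs, hsm⟩ := exists_contDiff_eq_sub_mul Real.contDiff_sin ha
      have hderiv : ∀ {f m : ℝ → ℝ}, ContDiff ℝ ∞ m → (∀ t, f t = (t - a) * m t) →
          deriv f a = m a := by
        intro f m hm hfm
        have h1 : HasDerivAt (fun t => (t - a) * m t) (1 * m a + (a - a) * deriv m a) a :=
          ((hasDerivAt_id a).sub_const a).mul ((hm.differentiable (by simp)) a).hasDerivAt
        rw [show f = fun t => (t - a) * m t from funext hfm, h1.deriv]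
        ring
      have hsa : s a = Real.cos a := by rw [← hderiv hs hsm, Real.deriv_sin]
      have hma : m a = deriv (deriv g) a := (hderiv hm hgm).symm
      have hca : Real.cos a ≠ 0 := by
        intro h
        have := Real.sin_sq_add_cos_sq a
        rw [ha, h] at this
        norm_num at this
      have hs0 : ∀ᶠ t in 𝓝 a, s t ≠ 0 := hs.continuous.continuousAt.eventually_ne (hsa ▸ hca)
      have hev : k =ᶠ[𝓝 a] fun t => -(m t / s t) := by
        filter_upwards [hs0] with t ht
        by_cases hta : t = a
        · subst hta; simp only [k, ha, if_true, hsa, hma]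
        · have h1 : Real.sin t ≠ 0 := by
            rw [hsm]; exact mul_ne_zero (sub_ne_zero.2 hta) ht
          simp only [k, h1, if_false]
          rw [hgm, hsm, mul_div_mul_left _ _ (sub_ne_zero.2 hta)]
      exact ((hm.contDiffAt.div hs.contDiffAt (hsa ▸ hca)).neg).congr_of_eventuallyEq hev
    · have hs0 : ∀ᶠ t in 𝓝 a, Real.sin t ≠ 0 :=
        Real.continuous_sin.continuousAt.eventually_ne ha
      have hev : k =ᶠ[𝓝 a] fun t => -(deriv g t / Real.sin t) := by
        filter_upwards [hs0] with t ht
        simp only [k, ht, if_false]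
      exact ((hdg.contDiffAt.div Real.contDiff_sin.contDiffAt ha).neg).congr_of_eventuallyEq hev
  · intro t
    simp only [k, Real.sin_add_two_pi, Real.cos_add_two_pi, hg.periodic.deriv_periodic t,
      hg.periodic.deriv_periodic.deriv_periodic t]
  · intro t
    have h1 : deriv (deriv g) (-t) = deriv (deriv g) t := by
      have h := deriv_comp_neg (deriv g) t
      rw [show (fun x => deriv g (-x)) = fun x => -deriv g x from funext hg.even.deriv_neg,
        deriv.fun_neg] at h
      linarith
    simp only [k, Real.sin_neg, Real.cos_neg, neg_eq_zero, hg.even.deriv_neg, h1, neg_div_neg_eq]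
  · intro t
    by_cases ht : Real.sin t = 0
    · simp [hg.deriv_eq_zero ht, ht]
    · simp only [k, ht, if_false]
      field_simp

/-- Since `arccos` is not differentiable at `±1`, the chain rule fails there. Instead, the
substitution `x = cos t` gives `g (arccos v) = g 0 + ∫ x in 1..v, k (arccos x)`, whose integrand is
continuous, so the fundamental theorem of calculus covers the endpoints too. -/
theorem hasDerivWithinAt_comp_arccos {g k : ℝ → ℝ} (hg : IsSmoothEvenPeriodic g)
    (hk : IsSmoothEvenPeriodic k) (hgk : ∀ t, deriv g t = -(Real.sin t * k t)) {u : ℝ}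
    (hu : u ∈ Icc (-1 : ℝ) 1) :
    HasDerivWithinAt (fun u => g (Real.arccos u)) (k (Real.arccos u)) (Icc (-1) 1) u := by
  have hgc := hg.smooth.continuous
  have hkc := hk.smooth.continuous
  have hac := Real.continuous_arccos
  have hint : ∀ v ∈ Icc (-1 : ℝ) 1,
      g (Real.arccos v) = g 0 + ∫ x in (1 : ℝ)..v, k (Real.arccos x) := by
    intro v hv
    have h1 : (∫ t in (0 : ℝ)..Real.arccos v, deriv g t) = g (Real.arccos v) - g 0 :=
      intervalIntegral.integral_deriv_eq_sub (fun t _ => (hg.smooth.differentiable (by simp)) t)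
        (((contDiff_infty_iff_deriv.1 hg.smooth).2).continuous.intervalIntegrable _ _)
    have h2 : (∫ t in (0 : ℝ)..Real.arccos v, deriv g t) =
        ∫ t in (0 : ℝ)..Real.arccos v, ((fun x => k (Real.arccos x)) ∘ Real.cos) t *
          (fun t => -Real.sin t) t := by
      refine intervalIntegral.integral_congr fun t ht => ?_
      rw [uIcc_of_le (Real.arccos_nonneg v)] at ht
      simp only [Function.comp_apply, Real.arccos_cos ht.1 (ht.2.trans (Real.arccos_le_pi v)), hgk]
      ring
    rw [intervalIntegral.integral_comp_mul_deriv (f' := fun t => -Real.sin t)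
      (fun t _ => Real.hasDerivAt_cos t) (by fun_prop) (by fun_prop), Real.cos_zero,
      Real.cos_arccos hv.1 hv.2] at h2
    linarith
  have hd : HasDerivAt (fun v => g 0 + ∫ x in (1 : ℝ)..v, k (Real.arccos x))
      (k (Real.arccos u)) u :=
    (intervalIntegral.integral_hasDerivAt_right
      (Continuous.intervalIntegrable (by fun_prop) _ _)
      (Continuous.stronglyMeasurableAtFilter (by fun_prop) _ _)
      (by fun_prop)).const_add _
  exact hd.hasDerivWithinAt.congr hint (hint u hu)

/-- The class of smooth even periodic functions is stable under differentiation in the cosine, so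
each order of smoothness follows from the previous one applied to `k`. -/
theorem IsSmoothEvenPeriodic.contDiffOn_comp_arccos {g : ℝ → ℝ} (hg : IsSmoothEvenPeriodic g) :
    ContDiffOn ℝ ∞ (fun u => g (Real.arccos u)) (Icc (-1) 1) := by
  have huniq : UniqueDiffOn ℝ (Icc (-1 : ℝ) 1) := uniqueDiffOn_Icc (by norm_num)
  refine contDiffOn_infty.2 fun n => ?_
  induction n generalizing g with
  | zero => exact contDiffOn_zero.2 (hg.smooth.continuous.comp Real.continuous_arccos).continuousOn
  | succ n ih =>
    obtain ⟨k, hk, hgk⟩ := hg.exists_deriv_eq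
    have hd := fun u hu => hasDerivWithinAt_comp_arccos hg hk hgk (u := u) hu
    rw [show ((n + 1 : ℕ) : WithTop ℕ∞) = (n : WithTop ℕ∞) + 1 by push_cast; rfl,
      contDiffOn_succ_iff_derivWithin huniq]
    refine ⟨fun u hu => (hd u hu).differentiableWithinAt, by simp, ?_⟩
    exact (ih hk).congr fun u hu => (hd u hu).derivWithin (huniq u hu)

/-! ### Differentials of axially symmetric maps on the sphere -/

section Axial

variable {n : ℕ}

local notation "𝔼" => EuclideanSpace ℝ (Fin (n + 1))

/-- The differential of the inclusion of the sphere. -/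
noncomputable def sphereIncl (x : UnitSphere n) : TangentSpace (𝓡 n) x →L[ℝ] 𝔼 :=
  mvfderiv (𝓡 n) ((↑) : UnitSphere n → 𝔼) x

theorem contMDiff_sphere_coe : ContMDiff (𝓡 n) 𝓘(ℝ, 𝔼) ∞ ((↑) : UnitSphere n → 𝔼) := by
  have := Fact.mk (@finrank_euclideanSpace_fin ℝ _ (n + 1))
  exact contMDiff_coe_sphere

theorem inner_sphereIncl (x : UnitSphere n) (v : TangentSpace (𝓡 n) x) :
    inner ℝ (x : 𝔼) (sphereIncl x v) = 0 := by
  have := Fact.mk (@finrank_euclideanSpace_fin ℝ _ (n + 1))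
  have h : sphereIncl x v ∈ (sphereIncl x).range := ⟨v, rfl⟩
  rw [sphereIncl, range_mvfderiv_subtypeVal] at h
  exact Submodule.mem_orthogonal_singleton_iff_inner_right.1 h

theorem exists_sphereIncl_eq (x : UnitSphere n) {w : 𝔼} (hw : inner ℝ (x : 𝔼) w = 0) :
    ∃ v, sphereIncl x v = w := by
  have := Fact.mk (@finrank_euclideanSpace_fin ℝ _ (n + 1))
  have h : w ∈ (ℝ ∙ (x : 𝔼))ᗮ := Submodule.mem_orthogonal_singleton_iff_inner_right.2 hw
  rw [← range_mvfderiv_subtypeVal (n := n)] at h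
  exact h

theorem sphereIncl_injective (x : UnitSphere n) : Function.Injective (sphereIncl x) := by
  have := Fact.mk (@finrank_euclideanSpace_fin ℝ _ (n + 1))
  exact injective_mvfderiv_subtypeVal_sphere x

/-- The cosine of the angle between a point of the sphere and the axis `e`. -/
noncomputable def height (e : 𝔼) (x : UnitSphere n) : ℝ := inner ℝ (x : 𝔼) e

theorem height_mem_Icc {e : 𝔼} (he : ‖e‖ = 1) (x : UnitSphere n) : height e x ∈ Icc (-1 : ℝ) 1 := by
  have hx : ‖(x : 𝔼)‖ = 1 := norm_eq_of_mem_sphere x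
  have := abs_real_inner_le_norm (x : 𝔼) e
  rw [hx, he, mul_one] at this
  exact abs_le.1 this

theorem contMDiff_height (e : 𝔼) : ContMDiff (𝓡 n) 𝓘(ℝ, ℝ) ∞ (height (n := n) e) := by
  have h : ContDiff ℝ ∞ (fun y : 𝔼 => inner ℝ y e) := contDiff_id.inner ℝ contDiff_const
  exact h.contMDiff.comp contMDiff_sphere_coe

theorem contMDiff_comp_height {e : 𝔼} (he : ‖e‖ = 1) {a : ℝ → ℝ}
    (ha : ContDiffOn ℝ ∞ a (Icc (-1) 1)) :
    ContMDiff (𝓡 n) 𝓘(ℝ, ℝ) ∞ (fun x : UnitSphere n => a (height e x)) :=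
  ha.contMDiffOn.comp_contMDiff (contMDiff_height e) (height_mem_Icc he)

theorem mvfderiv_height (e : 𝔼) (x : UnitSphere n) (v : TangentSpace (𝓡 n) x) :
    mvfderiv (𝓡 n) (height (n := n) e) x v = inner ℝ (sphereIncl x v) e := by
  have h : HasFDerivAt (fun y : 𝔼 => inner ℝ y e) (innerSL ℝ e) (x : 𝔼) := by
    have := (innerSL ℝ e).hasFDerivAt (x := (x : 𝔼))
    refine this.congr_of_eventuallyEq (Eventually.of_forall fun y => ?_)
    simp [real_inner_comm]
  have h1 : MDifferentiableAt (𝓡 n) 𝓘(ℝ, 𝔼) ((↑) : UnitSphere n → 𝔼) x :=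
    contMDiff_sphere_coe.mdifferentiableAt (by simp)
  have h2 := h.hasMFDerivAt.comp x h1.hasMFDerivAt
  have h3 : height (n := n) e = (fun y : 𝔼 => inner ℝ y e) ∘ ((↑) : UnitSphere n → 𝔼) := rfl
  rw [h3, mvfderiv, h2.mfderiv]
  exact real_inner_comm (sphereIncl x v) e

theorem mvfderiv_comp_height {e : 𝔼} (he : ‖e‖ = 1) {a : ℝ → ℝ} {a' : ℝ} (x : UnitSphere n)
    (ha : HasDerivWithinAt a a' (Icc (-1) 1) (height e x)) (v : TangentSpace (𝓡 n) x) :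
    mvfderiv (𝓡 n) (fun x : UnitSphere n => a (height e x)) x v =
      a' * inner ℝ (sphereIncl x v) e := by
  have h1 : MDifferentiableAt (𝓡 n) 𝓘(ℝ, ℝ) (height (n := n) e) x :=
    (contMDiff_height e).mdifferentiableAt (by simp)
  -- A one-sided derivative of `a` at `±1` is enough at the poles, because the height never leaves
  -- `[-1, 1]`.
  have h2 := HasMFDerivWithinAt.comp x ha.hasFDerivWithinAt.hasMFDerivWithinAt
    h1.hasMFDerivAt.hasMFDerivWithinAt (s := univ) (fun y _ => height_mem_Icc he y)
  rw [hasMFDerivWithinAt_univ] at h2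
  have h3 : (fun x : UnitSphere n => a (height e x)) = a ∘ height e := rfl
  rw [h3, mvfderiv, h2.mfderiv, ← mvfderiv_height, mul_comm]
  rfl

/-- The differential of an axially symmetric map of the sphere. -/
theorem mvfderiv_axial {e : 𝔼} (he : ‖e‖ = 1) (p : 𝔼) {a b : ℝ → ℝ} {a' b' : ℝ}
    (hac : ContDiffOn ℝ ∞ a (Icc (-1) 1)) (hbc : ContDiffOn ℝ ∞ b (Icc (-1) 1))
    (x : UnitSphere n)
    (ha : HasDerivWithinAt a a' (Icc (-1) 1) (height e x))
    (hb : HasDerivWithinAt b b' (Icc (-1) 1) (height e x)) (v : TangentSpace (𝓡 n) x) :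
    mvfderiv (𝓡 n) (fun x : UnitSphere n => p + (a (height e x) • (x : 𝔼) + b (height e x) • e)) x v
      = (a' * inner ℝ (sphereIncl x v) e) • (x : 𝔼) + a (height e x) • sphereIncl x v
        + (b' * inner ℝ (sphereIncl x v) e) • e := by
  have hma : MDifferentiableAt (𝓡 n) 𝓘(ℝ, ℝ) (fun x : UnitSphere n => a (height e x)) x :=
    (contMDiff_comp_height he hac).mdifferentiableAt (by simp)
  have hmb : MDifferentiableAt (𝓡 n) 𝓘(ℝ, ℝ) (fun x : UnitSphere n => b (height e x)) x :=
    (contMDiff_comp_height he hbc).mdifferentiableAt (by simp)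
  have hx : MDifferentiableAt (𝓡 n) 𝓘(ℝ, 𝔼) ((↑) : UnitSphere n → 𝔼) x :=
    contMDiff_sphere_coe.mdifferentiableAt (by simp)
  have hp : MDifferentiableAt (𝓡 n) 𝓘(ℝ, 𝔼) (fun _ : UnitSphere n => p) x :=
    mdifferentiableAt_const
  have hee : MDifferentiableAt (𝓡 n) 𝓘(ℝ, 𝔼) (fun _ : UnitSphere n => e) x :=
    mdifferentiableAt_const
  have h1 : MDifferentiableAt (𝓡 n) 𝓘(ℝ, 𝔼)
      (fun x : UnitSphere n => a (height e x) • (x : 𝔼)) x := hma.smul hx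
  have h2 : MDifferentiableAt (𝓡 n) 𝓘(ℝ, 𝔼)
      (fun x : UnitSphere n => b (height e x) • e) x := hmb.smul hee
  have h12 : MDifferentiableAt (𝓡 n) 𝓘(ℝ, 𝔼)
      (fun x : UnitSphere n => a (height e x) • (x : 𝔼) + b (height e x) • e) x := h1.add h2
  rw [mvfderiv_fun_add hp h12, mvfderiv_fun_add h1 h2, mvfderiv_fun_smul hma hx,
    mvfderiv_fun_smul hmb hee, mvfderiv_const, mvfderiv_const]
  simp only [add_apply, smul_apply,
    ContinuousLinearMap.smulRight_apply, mvfderiv_comp_height he x ha, mvfderiv_comp_height he x hb,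
    smul_zero, zero_add]
  rw [← sphereIncl]
  abel

end Axial

/-! ### Hypersurfaces of revolution -/

/-- `G` is a positive smooth function on `[-1, 1]` with first and second derivatives `G₁`, `G₂`: the
polar profile of a hypersurface of revolution as a function of the cosine of the polar angle. -/
structure IsAxialProfile (G G₁ G₂ : ℝ → ℝ) : Prop where
  pos : ∀ u ∈ Icc (-1 : ℝ) 1, 0 < G u
  smooth : ContDiffOn ℝ ∞ G (Icc (-1) 1)
  smooth_one : ContDiffOn ℝ ∞ G₁ (Icc (-1) 1)
  hasDeriv : ∀ u ∈ Icc (-1 : ℝ) 1, HasDerivWithinAt G (G₁ u) (Icc (-1) 1) u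
  hasDeriv_one : ∀ u ∈ Icc (-1 : ℝ) 1, HasDerivWithinAt G₁ (G₂ u) (Icc (-1) 1) u

/-- The norm of the velocity of the polar curve with profile `G`. -/
noncomputable def axialSpeed (G G₁ : ℝ → ℝ) (u : ℝ) : ℝ :=
  √(G u ^ 2 + (1 - u ^ 2) * G₁ u ^ 2)

/-- The curvature of the parallels. -/
noncomputable def parallelCurvature (G G₁ : ℝ → ℝ) (u : ℝ) : ℝ :=
  (G u + u * G₁ u) / (G u * axialSpeed G G₁ u)

/-- The curvature of the meridians. -/
noncomputable def meridianCurvature (G G₁ G₂ : ℝ → ℝ) (u : ℝ) : ℝ :=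
  (G u ^ 2 + 2 * ((1 - u ^ 2) * G₁ u ^ 2) - G u * ((1 - u ^ 2) * G₂ u - u * G₁ u)) /
    axialSpeed G G₁ u ^ 3

/-- The sum of the principal curvatures of the hypersurface of revolution with profile `G`. -/
noncomputable def curvatureSum (n : ℕ) (G G₁ G₂ : ℝ → ℝ) (u : ℝ) : ℝ :=
  (n - 1) * parallelCurvature G G₁ u + meridianCurvature G G₁ G₂ u

namespace IsAxialProfile

variable {G G₁ G₂ : ℝ → ℝ}

theorem radicand_pos (hG : IsAxialProfile G G₁ G₂) {u : ℝ} (hu : u ∈ Icc (-1 : ℝ) 1) :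
    0 < G u ^ 2 + (1 - u ^ 2) * G₁ u ^ 2 := by
  have h1 := pow_pos (hG.pos u hu) 2
  have h2 : 0 ≤ 1 - u ^ 2 := by nlinarith [hu.1, hu.2]
  have := mul_nonneg h2 (sq_nonneg (G₁ u))
  linarith

theorem speed_pos (hG : IsAxialProfile G G₁ G₂) {u : ℝ} (hu : u ∈ Icc (-1 : ℝ) 1) :
    0 < axialSpeed G G₁ u := Real.sqrt_pos.2 (hG.radicand_pos hu)

theorem speed_sq (hG : IsAxialProfile G G₁ G₂) {u : ℝ} (hu : u ∈ Icc (-1 : ℝ) 1) :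
    axialSpeed G G₁ u ^ 2 = G u ^ 2 + (1 - u ^ 2) * G₁ u ^ 2 := Real.sq_sqrt (hG.radicand_pos hu).le

theorem contDiffOn_speed (hG : IsAxialProfile G G₁ G₂) :
    ContDiffOn ℝ ∞ (axialSpeed G G₁) (Icc (-1) 1) := by
  refine ContDiffOn.sqrt ?_ fun u hu => (hG.radicand_pos hu).ne'
  exact (hG.smooth.pow 2).add ((contDiffOn_const.sub (contDiffOn_id.pow 2)).mul (hG.smooth_one.pow 2))

theorem hasDeriv_speed (hG : IsAxialProfile G G₁ G₂) {u : ℝ} (hu : u ∈ Icc (-1 : ℝ) 1) :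
    HasDerivWithinAt (axialSpeed G G₁)
      (G₁ u * (G u + (1 - u ^ 2) * G₂ u - u * G₁ u) / axialSpeed G G₁ u) (Icc (-1) 1) u := by
  have h1 : HasDerivWithinAt (fun u : ℝ => 1 - u ^ 2) (-(2 * u)) (Icc (-1) 1) u := by
    simpa using ((hasDerivAt_pow 2 u).const_sub 1).hasDerivWithinAt (s := Icc (-1 : ℝ) 1)
  have h2 := (((hG.hasDeriv u hu).fun_pow 2).fun_add (h1.fun_mul ((hG.hasDeriv_one u hu).fun_pow 2))).sqrt
    (hG.radicand_pos hu).ne'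
  refine h2.congr_deriv ?_
  have := (hG.speed_pos hu).ne'
  rw [axialSpeed] at this ⊢
  field_simp
  push_cast
  ring

/-- The coefficient of the position vector in the unit normal. -/
noncomputable def _root_.HBubble.normalRadial (G G₁ : ℝ → ℝ) (u : ℝ) : ℝ :=
  (G u + u * G₁ u) / axialSpeed G G₁ u

/-- The coefficient of the axis in the unit normal. -/
noncomputable def _root_.HBubble.normalAxial (G G₁ : ℝ → ℝ) (u : ℝ) : ℝ :=
  -(G₁ u / axialSpeed G G₁ u)

theorem contDiffOn_normalRadial (hG : IsAxialProfile G G₁ G₂) :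
    ContDiffOn ℝ ∞ (normalRadial G G₁) (Icc (-1) 1) :=
  (hG.smooth.add (contDiffOn_id.mul hG.smooth_one)).div hG.contDiffOn_speed
    fun _ hu => (hG.speed_pos hu).ne'

theorem contDiffOn_normalAxial (hG : IsAxialProfile G G₁ G₂) :
    ContDiffOn ℝ ∞ (normalAxial G G₁) (Icc (-1) 1) :=
  (hG.smooth_one.div hG.contDiffOn_speed fun _ hu => (hG.speed_pos hu).ne').neg

/-- The derivatives of the coefficients of the unit normal, in terms of the curvatures. -/
theorem exists_hasDeriv_normal (hG : IsAxialProfile G G₁ G₂) {u : ℝ} (hu : u ∈ Icc (-1 : ℝ) 1) :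
    ∃ P' Q' : ℝ, HasDerivWithinAt (normalRadial G G₁) P' (Icc (-1) 1) u ∧
      HasDerivWithinAt (normalAxial G G₁) Q' (Icc (-1) 1) u ∧
      normalRadial G G₁ u + (1 - u ^ 2) * Q' = G u * meridianCurvature G G₁ G₂ u ∧
      P' + Q' * u = G₁ u * meridianCurvature G G₁ G₂ u := by
  have hW := (hG.speed_pos hu).ne'
  have hWsq := hG.speed_sq hu
  have h1 : HasDerivWithinAt (fun u => G u + u * G₁ u) (G₁ u + (1 * G₁ u + u * G₂ u))
      (Icc (-1) 1) u :=
    (hG.hasDeriv u hu).add ((hasDerivWithinAt_id u _).mul (hG.hasDeriv_one u hu))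
  refine ⟨_, _, h1.div (hG.hasDeriv_speed hu) hW,
    ((hG.hasDeriv_one u hu).div (hG.hasDeriv_speed hu) hW).neg, ?_, ?_⟩
  -- Once denominators are cleared, both identities are multiples of the relation `W² = G² + (1 -
  -- u²) G₁²`.
  · rw [normalRadial, meridianCurvature]
    generalize axialSpeed G G₁ u = W at *
    field_simp
    linear_combination (G u + u * G₁ u - (1 - u ^ 2) * G₂ u) * hWsq
  · rw [meridianCurvature]
    generalize axialSpeed G G₁ u = W at *
    field_simp
    linear_combination 2 * G₁ u * hWsq

variable {n : ℕ}

local notation "𝔼" => EuclideanSpace ℝ (Fin (n + 1))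

/-- A hypersurface of revolution about the axis `e`, rescaled by `r⁻¹`. -/
noncomputable def _root_.HBubble.revolutionMap (G : ℝ → ℝ) (r c : ℝ) (p e : 𝔼) (x : UnitSphere n) : 𝔼 :=
  p + ((r⁻¹ * G (height e x)) • (x : 𝔼) + (r⁻¹ * c) • e)

/-- The shape operator is a multiple of the identity plus a rank-one term along the meridian. This
form needs no splitting into parallels and meridians and stays valid at the poles, where the
meridian direction degenerates to 0. The rescaling by `r⁻¹` accounts for the factor `r` in the
curvature. -/
theorem isBubble_range_revolutionMap (hn : 1 ≤ n) (hG : IsAxialProfile G G₁ G₂) {r : ℝ} (hr : 0 < r)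
    (c : ℝ) (p : 𝔼) {e : 𝔼} (he : ‖e‖ = 1) {H : 𝔼 → ℝ}
    (hH : ∀ x : UnitSphere n, H (revolutionMap G r c p e x) =
      r / n * curvatureSum n G G₁ G₂ (height e x)) :
    IsBubble H (range (revolutionMap G r c p e)) := by
  have hx1 : ∀ x : UnitSphere n, ‖(x : 𝔼)‖ = 1 := fun x => norm_eq_of_mem_sphere x
  have hxx : ∀ x : UnitSphere n, inner ℝ (x : 𝔼) (x : 𝔼) = 1 := fun x => by
    rw [real_inner_self_eq_norm_sq, hx1, one_pow]
  have hee : inner ℝ e e = 1 := by rw [real_inner_self_eq_norm_sq, he, one_pow]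
  have hmem := height_mem_Icc he
  have hac : ContDiffOn ℝ ∞ (fun u => r⁻¹ * G u) (Icc (-1) 1) := contDiffOn_const.mul hG.smooth
  have hbc : ContDiffOn ℝ ∞ (fun _ : ℝ => r⁻¹ * c) (Icc (-1) 1) := contDiffOn_const
  have hdΦ : ∀ (x : UnitSphere n) (v : TangentSpace (𝓡 n) x),
      mvfderiv (𝓡 n) (revolutionMap G r c p e) x v =
        (r⁻¹ * G₁ (height e x) * inner ℝ (sphereIncl x v) e) • (x : 𝔼) +
          (r⁻¹ * G (height e x)) • sphereIncl x v := by
    intro x v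
    refine (mvfderiv_axial he p hac hbc x ((hG.hasDeriv _ (hmem x)).const_mul r⁻¹)
      (hasDerivWithinAt_const _ _ _) v).trans ?_
    simp
  let N : UnitSphere n → 𝔼 := fun x =>
    0 + (normalRadial G G₁ (height e x) • (x : 𝔼) + normalAxial G G₁ (height e x) • e)
  have hsmooth : ∀ (q : 𝔼) {a b : ℝ → ℝ}, ContDiffOn ℝ ∞ a (Icc (-1) 1) →
      ContDiffOn ℝ ∞ b (Icc (-1) 1) → ContMDiff (𝓡 n) 𝓘(ℝ, 𝔼) ∞
        (fun x : UnitSphere n => q + (a (height e x) • (x : 𝔼) + b (height e x) • e)) := by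
    intro q a b ha hb
    exact contMDiff_const.add (((contMDiff_comp_height he ha).smul contMDiff_sphere_coe).add
      ((contMDiff_comp_height he hb).smul contMDiff_const))
  refine ⟨revolutionMap G r c p e, N, ⟨hsmooth p hac hbc, ?_, ?_⟩, rfl, ⟨?_, ?_, ?_⟩, ?_⟩
  · intro x y hxy
    have h1 : (r⁻¹ * G (height e x)) • (x : 𝔼) = (r⁻¹ * G (height e y)) • (y : 𝔼) :=
      add_right_cancel (add_left_cancel hxy)
    have hpx := mul_pos (inv_pos.2 hr) (hG.pos _ (hmem x))
    have hpy := mul_pos (inv_pos.2 hr) (hG.pos _ (hmem y))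
    have h2 := congrArg norm h1
    rw [norm_smul, norm_smul, hx1, hx1, mul_one, mul_one, Real.norm_of_nonneg hpx.le,
      Real.norm_of_nonneg hpy.le] at h2
    rw [h2] at h1
    exact Subtype.ext (smul_right_injective 𝔼 hpy.ne' h1)
  · intro x
    rw [injective_iff_map_eq_zero]
    intro v hv
    rw [hdΦ] at hv
    have hpx := mul_pos (inv_pos.2 hr) (hG.pos _ (hmem x))
    have h1 := congrArg (inner ℝ (x : 𝔼)) hv
    rw [inner_add_right, inner_smul_right, inner_smul_right, inner_sphereIncl, hxx, inner_zero_right,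
      mul_zero, add_zero, mul_one] at h1
    rw [h1, zero_smul, zero_add, smul_eq_zero] at hv
    exact sphereIncl_injective x ((hv.resolve_left hpx.ne').trans (map_zero _).symm)
  · exact hsmooth 0 hG.contDiffOn_normalRadial hG.contDiffOn_normalAxial
  · intro x
    have hW := (hG.speed_pos (hmem x)).ne'
    have hWsq := hG.speed_sq (hmem x)
    have h1 : ‖N x‖ ^ 2 = 1 := by
      rw [← real_inner_self_eq_norm_sq]
      simp only [N, zero_add, inner_add_left, inner_add_right, inner_smul_left, inner_smul_right, hxx,
        hee, real_inner_comm (x : 𝔼) e, ← show height e x = inner ℝ (x : 𝔼) e from rfl,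
        normalRadial, normalAxial, conj_trivial]
      generalize axialSpeed G G₁ (height e x) = W at *
      field_simp
      linear_combination -hWsq
    nlinarith [norm_nonneg (N x)]
  · intro x v
    rw [hdΦ]
    simp only [N, zero_add, inner_add_left, inner_add_right, inner_smul_left, inner_smul_right, hxx,
      real_inner_comm (x : 𝔼) e, ← show height e x = inner ℝ (x : 𝔼) e from rfl,
      real_inner_comm (sphereIncl x v) e, inner_sphereIncl,
      normalRadial, normalAxial, conj_trivial]
    ring
  · intro x
    set u := height e x with hu
    obtain ⟨P', Q', hP, hQ, h1, h2⟩ := hG.exists_hasDeriv_normal (hmem x)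
    rw [← hu] at hP hQ h1 h2
    have hGu := (hG.pos u (hmem x)).ne'
    have hWu := (hG.speed_pos (hmem x)).ne'
    rw [← hu] at hWu
    -- The axis splits as `e = u x + w` with `w` tangent to the sphere at `x`.
    have hew : inner ℝ (x : 𝔼) (e - u • (x : 𝔼)) = 0 := by
      rw [inner_sub_right, inner_smul_right, hxx, hu, height]; ring
    obtain ⟨w, hw⟩ := exists_sphereIncl_eq x hew
    let φ : TangentSpace (𝓡 n) x →ₗ[ℝ] ℝ := (innerₗ 𝔼 e).comp (sphereIncl x).toLinearMap
    have hφ : ∀ v, φ v = inner ℝ (sphereIncl x v) e := fun v => by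
      simp [φ, real_inner_comm]
    have hφw : φ w = 1 - u ^ 2 := by
      rw [hφ, hw, inner_sub_left, inner_smul_left, hee, hu, height]
      simp only [conj_trivial]; ring
    -- With `P = normalRadial`, `dN v = (P' + Q' u) φ(v) x + P v + Q' φ(v) w`. Matching tangential
    -- parts with `dΦ (L v)` dictates `L`; the parts along `x` then agree by `h1` and `h2`. The
    -- trace follows from `φ w = 1 - u²`.
    refine ⟨(r / G u) • (normalRadial G G₁ u • LinearMap.id + Q' • φ.smulRight w), fun v => ?_, ?_⟩
    · have hN := mvfderiv_axial he 0 hG.contDiffOn_normalRadial hG.contDiffOn_normalAxial x hP hQ v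
      rw [show mvfderiv (𝓡 n) N x v = _ from hN, hdΦ, ← hu, ← hφ, ← hφ]
      simp only [LinearMap.smul_apply, LinearMap.add_apply, LinearMap.id_apply,
        LinearMap.smulRight_apply, map_smul, map_add, hφw, hw, smul_eq_mul]
      have e1 : r⁻¹ * G₁ u * (r / G u * (normalRadial G G₁ u * φ v + Q' * (φ v * (1 - u ^ 2)))) =
          (P' + Q' * u) * φ v := by
        rw [h2]
        have : normalRadial G G₁ u * φ v + Q' * (φ v * (1 - u ^ 2)) =
          G u * meridianCurvature G G₁ G₂ u * φ v := by rw [← h1]; ring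
        rw [this]
        field_simp
      have e2 : r⁻¹ * G u * (r / G u) = 1 := by field_simp
      rw [e1, smul_smul (r⁻¹ * G u), e2, one_smul]
      module
    · have hfree : Module.Free ℝ (TangentSpace (𝓡 n) x) :=
        inferInstanceAs (Module.Free ℝ (EuclideanSpace ℝ (Fin n)))
      have hfin : Module.Finite ℝ (TangentSpace (𝓡 n) x) :=
        inferInstanceAs (Module.Finite ℝ (EuclideanSpace ℝ (Fin n)))
      have htr : LinearMap.trace ℝ (TangentSpace (𝓡 n) x) LinearMap.id = n := by
        rw [LinearMap.trace_id]
        exact_mod_cast finrank_euclideanSpace_fin (𝕜 := ℝ) (n := n)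
      rw [hH, map_smul, map_add, map_smul, map_smul, htr, LinearMap.trace_smulRight, hφw, ← hu,
        curvatureSum, parallelCurvature]
      simp only [smul_eq_mul]
      have e1 : normalRadial G G₁ u * n + Q' * (1 - u ^ 2) =
          (n - 1) * normalRadial G G₁ u + G u * meridianCurvature G G₁ G₂ u := by
        rw [← h1]; ring
      have hn0 : (n : ℝ) ≠ 0 := by positivity
      rw [e1, normalRadial]
      field_simp

end IsAxialProfile

/-! ### Inverting and extending functions on a closed interval -/

/-- The inverse function theorem on a closed interval. -/
theorem exists_contDiffOn_inverse_Icc {a b : ℝ} (hab : a < b) {s s' : ℝ → ℝ}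
    (hs : ContDiffOn ℝ ∞ s (Icc a b)) (hs' : ∀ x ∈ Icc a b, HasDerivWithinAt s (s' x) (Icc a b) x)
    (hpos : ∀ x ∈ Icc a b, 0 < s' x) :
    StrictMonoOn s (Icc a b) ∧ s '' Icc a b = Icc (s a) (s b) ∧
      ∃ σ : ℝ → ℝ, MapsTo σ (Icc (s a) (s b)) (Icc a b) ∧
        (∀ y ∈ Icc (s a) (s b), s (σ y) = y) ∧ (∀ x ∈ Icc a b, σ (s x) = x) ∧
        ContDiffOn ℝ ∞ σ (Icc (s a) (s b)) ∧
        ∀ y ∈ Icc (s a) (s b), HasDerivWithinAt σ (s' (σ y))⁻¹ (Icc (s a) (s b)) y := by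
  have ha : a ∈ Icc a b := left_mem_Icc.2 hab.le
  have hb : b ∈ Icc a b := right_mem_Icc.2 hab.le
  have hmono : StrictMonoOn s (Icc a b) := by
    refine strictMonoOn_of_deriv_pos (convex_Icc a b) hs.continuousOn fun x hx => ?_
    have hx' : x ∈ Icc a b := interior_subset hx
    have := (hs' x hx').hasDerivAt (mem_interior_iff_mem_nhds.1 hx)
    rw [this.deriv]
    exact hpos x hx'
  have himage : s '' Icc a b = Icc (s a) (s b) := by
    refine Subset.antisymm ?_ (intermediate_value_Icc hab.le hs.continuousOn)
    rintro _ ⟨x, hx, rfl⟩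
    exact ⟨hmono.monotoneOn ha hx hx.1, hmono.monotoneOn hx hb hx.2⟩
  have hsab : s a < s b := hmono ha hb hab
  let σ := Function.invFunOn s (Icc a b)
  have hmaps : MapsTo σ (Icc (s a) (s b)) (Icc a b) := fun y hy =>
    Function.invFunOn_mem (himage.symm ▸ hy : y ∈ s '' Icc a b)
  have hright : ∀ y ∈ Icc (s a) (s b), s (σ y) = y := fun y hy =>
    Function.invFunOn_eq (himage.symm ▸ hy : y ∈ s '' Icc a b)
  have hleft : ∀ x ∈ Icc a b, σ (s x) = x := fun x hx => hmono.injOn.leftInvOn_invFunOn hx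
  -- The map `s` sends closed subsets of the compact interval to compact, hence closed, sets, so its
  -- inverse is continuous.
  have hcont : ContinuousOn σ (Icc (s a) (s b)) := by
    refine continuousOn_iff_isClosed.2 fun t ht => ⟨s '' (t ∩ Icc a b), ?_, ?_⟩
    · exact ((isCompact_Icc.inter_left ht).image_of_continuousOn
        (hs.continuousOn.mono inter_subset_right)).isClosed
    · ext y
      constructor
      · rintro ⟨hy1, hy2⟩
        exact ⟨⟨σ y, ⟨hy1, hmaps hy2⟩, hright y hy2⟩, hy2⟩
      · rintro ⟨⟨x, ⟨hx1, hx2⟩, rfl⟩, hy2⟩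
        exact ⟨by rwa [mem_preimage, hleft x hx2], hy2⟩
  have hderiv : ∀ y ∈ Icc (s a) (s b),
      HasDerivWithinAt σ (s' (σ y))⁻¹ (Icc (s a) (s b)) y := by
    intro y hy
    have h0 := (hpos (σ y) (hmaps hy)).ne'
    exact HasFDerivWithinAt.of_local_left_inverse
      (f' := ContinuousLinearEquiv.unitsEquivAut ℝ (Units.mk0 (s' (σ y)) h0))
      (tendsto_nhdsWithin_iff.2 ⟨hcont y hy, eventually_mem_nhdsWithin.mono hmaps⟩)
      (hs' (σ y) (hmaps hy)) hy (eventually_mem_nhdsWithin.mono hright)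
  refine ⟨hmono, himage, σ, hmaps, hright, hleft, contDiffOn_infty.2 fun k => ?_, hderiv⟩
  have huniq := uniqueDiffOn_Icc hab
  have huniq' := uniqueDiffOn_Icc hsab
  have hs'c : ContDiffOn ℝ ∞ s' (Icc a b) :=
    ((contDiffOn_infty_iff_derivWithin huniq).1 hs).2.congr
      fun x hx => ((hs' x hx).derivWithin (huniq x hx)).symm
  -- Bootstrap: `σ' = 1 / s'(σ)` is as regular as `σ`, so `σ` gains one derivative at each step.
  induction k with
  | zero => exact contDiffOn_zero.2 hcont
  | succ k ih =>
    rw [show ((k + 1 : ℕ) : WithTop ℕ∞) = (k : WithTop ℕ∞) + 1 by push_cast; rfl,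
      contDiffOn_succ_iff_derivWithin huniq']
    refine ⟨fun y hy => (hderiv y hy).differentiableWithinAt, by simp, ?_⟩
    have h1 : ContDiffOn ℝ k (fun y => (s' (σ y))⁻¹) (Icc (s a) (s b)) :=
      ((hs'c.of_le (by exact_mod_cast le_top)).comp ih hmaps).inv
        fun y hy => (hpos _ (hmaps hy)).ne'
    exact h1.congr fun y hy => (hderiv y hy).derivWithin (huniq' y hy)

/-- Extending a `C¹` function by a constant across a critical endpoint. -/
theorem contDiffOn_one_ite_Icc {a b c : ℝ} (hab : a < b) {F : ℝ → ℝ}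
    (hF : ContDiffOn ℝ 1 F (Icc a b)) (hc : F b = c) (hb : HasDerivWithinAt F 0 (Icc a b) b) :
    ContDiffOn ℝ 1 (fun y => if y ≤ b then F y else c) (Ici a) := by
  have huniq := uniqueDiffOn_Icc hab
  have huniq' := uniqueDiffOn_Ici a
  obtain ⟨hFd, hFc⟩ := (contDiffOn_one_iff_derivWithin huniq).1 hF
  have hbmem : b ∈ Icc a b := right_mem_Icc.2 hab.le
  -- The derivative of `F`, continued to the right of `b` by its value there, namely 0, is
  -- continuous and is the derivative of the extended function.
  have hext : Continuous (IccExtend hab.le ((Icc a b).domRestrict (derivWithin F (Icc a b)))) :=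
    (continuousOn_iff_continuous_domRestrict.1 hFc).Icc_extend'
  set D := IccExtend hab.le ((Icc a b).domRestrict (derivWithin F (Icc a b))) with hD
  have hDin : ∀ y ∈ Icc a b, D y = derivWithin F (Icc a b) y := fun y hy => by
    rw [hD, IccExtend_of_mem _ _ hy, domRestrict_apply]
  have hDout : ∀ y, b ≤ y → D y = 0 := fun y hy => by
    rw [hD, IccExtend_of_right_le _ _ hy, domRestrict_apply]
    exact hb.derivWithin (huniq b hbmem)
  have hunion : Icc a b ∪ Ici b = Ici a := Icc_union_Ici_eq_Ici hab.le
  have hderiv : ∀ y ∈ Ici a, HasDerivWithinAt (fun y => if y ≤ b then F y else c) (D y) (Ici a) y := by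
    intro y hy
    have hleft : y ≤ b →
        HasDerivWithinAt (fun y => if y ≤ b then F y else c) (D y) (Icc a b) y := by
      intro hyb
      have hy' : y ∈ Icc a b := ⟨hy, hyb⟩
      rw [hDin y hy']
      exact (hFd y hy').hasDerivWithinAt.congr (fun z hz => if_pos hz.2) (if_pos hyb)
    have hright : b ≤ y →
        HasDerivWithinAt (fun y => if y ≤ b then F y else c) (D y) (Ici b) y := by
      intro hby
      rw [hDout y hby]
      refine (hasDerivWithinAt_const y (Ici b) c).congr_of_mem (fun z hz => ?_) hby
      split_ifs with hzb
      · rw [le_antisymm hzb hz, hc]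
      · rfl
    rcases lt_trichotomy y b with h | h | h
    · refine (hleft h.le).mono_of_mem_nhdsWithin ?_
      rw [← Ici_inter_Iic]
      exact inter_mem self_mem_nhdsWithin (mem_nhdsWithin_of_mem_nhds (Iic_mem_nhds h))
    · rw [← hunion]
      exact (hleft h.le).union (hright h.ge)
    · exact (hright h.le).mono_of_mem_nhdsWithin (mem_nhdsWithin_of_mem_nhds (Ici_mem_nhds h))
  refine (contDiffOn_one_iff_derivWithin huniq').2
    ⟨fun y hy => (hderiv y hy).differentiableWithinAt, ?_⟩
  exact hext.continuousOn.congr fun y hy => (hderiv y hy).derivWithin (huniq' y hy)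

/-- Extending a smooth function which is constant near an endpoint. -/
theorem contDiffOn_ite_Icc {k : WithTop ℕ∞} {a b c : ℝ} {F : ℝ → ℝ}
    (hF : ContDiffOn ℝ k F (Icc a b)) (hc : ∀ᶠ y in 𝓝[Icc a b] b, F y = c) (hab : a < b) :
    ContDiffOn ℝ k (fun y => if y ≤ b then F y else c) (Ici a) := by
  intro y hy
  rcases lt_or_ge y b with h | h
  · have h1 : ContDiffWithinAt ℝ k F (Ici a) y := by
      refine (hF y ⟨hy, h.le⟩).mono_of_mem_nhdsWithin ?_
      rw [← Ici_inter_Iic]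
      exact inter_mem self_mem_nhdsWithin (mem_nhdsWithin_of_mem_nhds (Iic_mem_nhds h))
    refine h1.congr_of_eventuallyEq ?_ (if_pos h.le)
    filter_upwards [mem_nhdsWithin_of_mem_nhds (Iio_mem_nhds h)] with z hz
    exact if_pos (le_of_lt hz)
  · have h0 : ∀ᶠ z in 𝓝 b, z ∈ Icc a b → F z = c := eventually_nhdsWithin_iff.1 hc
    have h1 : ∀ᶠ z in 𝓝 y, (if z ≤ b then F z else c) = c := by
      rcases h.lt_or_eq with h | rfl
      · filter_upwards [Ioi_mem_nhds h] with z hz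
        exact if_neg (not_le.2 hz)
      · filter_upwards [h0, Ioi_mem_nhds hab] with z hz hza
        split_ifs with hzb
        · exact hz ⟨le_of_lt hza, hzb⟩
        · rfl
    exact (contDiffAt_const.congr_of_eventuallyEq h1).contDiffWithinAt

/-! ### The perturbed profile as a function of the cosine -/

/-- `h₁`, `h₂`, `h₃` are the successive derivatives of `h` with respect to the cosine, with the
vanishing conditions that make the curvature of the profile flat at the poles. -/
structure HasCosDerivs (h h₁ h₂ h₃ : ℝ → ℝ) : Prop where
  base : IsSmoothEvenPeriodic h
  one : IsSmoothEvenPeriodic h₁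
  two : IsSmoothEvenPeriodic h₂
  three : IsSmoothEvenPeriodic h₃
  deriv_base : ∀ t, deriv h t = -(Real.sin t * h₁ t)
  deriv_one : ∀ t, deriv h₁ t = -(Real.sin t * h₂ t)
  deriv_two : ∀ t, deriv h₂ t = -(Real.sin t * h₃ t)
  one_zero : h₁ 0 = 0
  one_pi : h₁ Real.pi = 0
  two_zero : h₂ 0 = 0

theorem IsSmoothEvenPeriodic.hasDerivAt {g : ℝ → ℝ} (hg : IsSmoothEvenPeriodic g) (t : ℝ) :
    HasDerivAt g (deriv g t) t := (hg.smooth.differentiable (by simp) t).hasDerivAt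

theorem deriv_deriv_of_cos {h h₁ h₂ : ℝ → ℝ} (hh₁ : IsSmoothEvenPeriodic h₁)
    (hd : ∀ t, deriv h t = -(Real.sin t * h₁ t)) (hd₁ : ∀ t, deriv h₁ t = -(Real.sin t * h₂ t))
    (t : ℝ) : deriv (deriv h) t = Real.sin t ^ 2 * h₂ t - Real.cos t * h₁ t := by
  rw [show deriv h = _ from funext hd]
  refine ((Real.hasDerivAt_sin t).fun_mul (hh₁.hasDerivAt t)).fun_neg.deriv.trans ?_
  rw [hd₁]; ring

theorem exists_hasCosDerivs {h : ℝ → ℝ} (hh : IsSmoothEvenPeriodic h)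
    (h_two_zero : iteratedDeriv 2 h 0 = 0) (h_four_zero : iteratedDeriv 4 h 0 = 0)
    (h_two_pi : iteratedDeriv 2 h Real.pi = 0) : ∃ h₁ h₂ h₃, HasCosDerivs h h₁ h₂ h₃ := by
  obtain ⟨h₁, hh₁, hd⟩ := hh.exists_deriv_eq
  obtain ⟨h₂, hh₂, hd₁⟩ := hh₁.exists_deriv_eq
  obtain ⟨h₃, hh₃, hd₂⟩ := hh₂.exists_deriv_eq
  have e2 : iteratedDeriv 2 h = fun t => Real.sin t ^ 2 * h₂ t - Real.cos t * h₁ t := by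
    rw [iteratedDeriv_succ, iteratedDeriv_one]
    exact funext (deriv_deriv_of_cos hh₁ hd hd₁)
  have e3 : iteratedDeriv 3 h = fun t => Real.sin t *
      (h₁ t + 3 * Real.cos t * h₂ t - Real.sin t ^ 2 * h₃ t) := by
    rw [iteratedDeriv_succ, e2]
    refine funext fun t => ?_
    refine ((((Real.hasDerivAt_sin t).fun_pow 2).fun_mul (hh₂.hasDerivAt t)).fun_sub
      ((Real.hasDerivAt_cos t).fun_mul (hh₁.hasDerivAt t))).deriv.trans ?_
    rw [hd₁, hd₂]
    push_cast
    ring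
  -- The third derivative is `sin t` times a differentiable bracket, so its derivative at 0 is just
  -- the bracket at 0.
  have e4 : iteratedDeriv 4 h 0 = h₁ 0 + 3 * h₂ 0 := by
    rw [iteratedDeriv_succ, e3]
    have hdiff : DifferentiableAt ℝ
        (fun t => h₁ t + 3 * Real.cos t * h₂ t - Real.sin t ^ 2 * h₃ t) 0 := by
      have := (hh₁.hasDerivAt 0).differentiableAt
      have := (hh₂.hasDerivAt 0).differentiableAt
      have := (hh₃.hasDerivAt 0).differentiableAt
      fun_prop
    refine ((Real.hasDerivAt_sin 0).fun_mul hdiff.hasDerivAt).deriv.trans ?_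
    simp
  have z1 : h₁ 0 = 0 := by
    rw [e2] at h_two_zero
    simpa using h_two_zero
  refine ⟨h₁, h₂, h₃, hh, hh₁, hh₂, hh₃, hd, hd₁, hd₂, z1, ?_, ?_⟩
  · rw [e2] at h_two_pi
    simpa using h_two_pi
  · rw [e4, z1] at h_four_zero
    linarith

/-- The profile `1 + ε h` as a function of the cosine. -/
noncomputable def cosProfile (h : ℝ → ℝ) (ε u : ℝ) : ℝ := 1 + ε * h (Real.arccos u)

/-- The derivatives of the profile as functions of the cosine. -/
noncomputable def cosDeriv (k : ℝ → ℝ) (ε u : ℝ) : ℝ := ε * k (Real.arccos u)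

/-- The squared distance from the south pole to the hypersurface with profile `G`, as a function of
the cosine of the polar angle. -/
noncomputable def poleDistSq (G : ℝ → ℝ) (u : ℝ) : ℝ :=
  G u ^ 2 + G (-1) ^ 2 + 2 * G (-1) * (u * G u)

/-- The derivative of `poleDistSq`. -/
noncomputable def poleDistSqDeriv (G G₁ : ℝ → ℝ) (u : ℝ) : ℝ :=
  2 * G u * G₁ u + 2 * G (-1) * (G u + u * G₁ u)

/-- The mean curvature of the rescaled hypersurface. -/
noncomputable def scaledMeanCurvature (n : ℕ) (G G₁ G₂ : ℝ → ℝ) (u : ℝ) : ℝ :=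
  G 1 / n * curvatureSum n G G₁ G₂ u

theorem hasDerivWithinAt_poleDistSq {G G₁ G₂ : ℝ → ℝ} (hG : IsAxialProfile G G₁ G₂) {u : ℝ}
    (hu : u ∈ Icc (-1 : ℝ) 1) :
    HasDerivWithinAt (poleDistSq G) (poleDistSqDeriv G G₁ u) (Icc (-1) 1) u := by
  have h1 := hG.hasDeriv u hu
  refine (((h1.fun_pow 2).add_const (G (-1) ^ 2)).fun_add
    (((hasDerivWithinAt_id u _).fun_mul h1).const_mul (2 * G (-1)))).congr_deriv ?_
  simp only [poleDistSqDeriv, id]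
  push_cast
  ring

theorem contDiffOn_poleDistSq {G G₁ G₂ : ℝ → ℝ} (hG : IsAxialProfile G G₁ G₂) :
    ContDiffOn ℝ ∞ (poleDistSq G) (Icc (-1) 1) :=
  ((hG.smooth.pow 2).add contDiffOn_const).add (contDiffOn_const.mul (contDiffOn_id.mul hG.smooth))

theorem poleDistSq_neg_one (G : ℝ → ℝ) : poleDistSq G (-1) = 0 := by
  simp only [poleDistSq]; ring

theorem poleDistSq_one (G : ℝ → ℝ) : poleDistSq G 1 = (G 1 + G (-1)) ^ 2 := by
  simp only [poleDistSq]; ring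

theorem contDiffOn_scaledMeanCurvature (n : ℕ) {G G₁ G₂ : ℝ → ℝ} (hG : IsAxialProfile G G₁ G₂)
    (hG₂ : ContDiffOn ℝ ∞ G₂ (Icc (-1) 1)) :
    ContDiffOn ℝ ∞ (scaledMeanCurvature n G G₁ G₂) (Icc (-1) 1) := by
  have hid : ContDiffOn ℝ ∞ (fun u : ℝ => u) (Icc (-1) 1) := contDiffOn_id
  have hs : ContDiffOn ℝ ∞ (fun u : ℝ => 1 - u ^ 2) (Icc (-1) 1) :=
    contDiffOn_const.sub (hid.pow 2)
  have hG0 := hG.smooth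
  have hG1 := hG.smooth_one
  refine contDiffOn_const.mul ((contDiffOn_const.mul ?_).add ?_)
  · exact (hG0.add (hid.mul hG1)).div (hG0.mul hG.contDiffOn_speed)
      fun u hu => (mul_pos (hG.pos u hu) (hG.speed_pos hu)).ne'
  · exact (((hG0.pow 2).add (contDiffOn_const.mul (hs.mul (hG1.pow 2)))).sub
      (hG0.mul ((hs.mul hG₂).sub (hid.mul hG1)))).div (hG.contDiffOn_speed.pow 3)
      fun u hu => (pow_pos (hG.speed_pos hu) 3).ne'

theorem one_mem_Icc_neg_one : (1 : ℝ) ∈ Icc (-1 : ℝ) 1 := by norm_num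

theorem axialSpeed_one {G G₁ G₂ : ℝ → ℝ} (hG : IsAxialProfile G G₁ G₂) (h1 : G₁ 1 = 0) :
    axialSpeed G G₁ 1 = G 1 := by
  rw [axialSpeed, h1]
  simpa using Real.sqrt_sq (hG.pos 1 one_mem_Icc_neg_one).le

theorem scaledMeanCurvature_one {n : ℕ} (hn : 1 ≤ n) {G G₁ G₂ : ℝ → ℝ}
    (hG : IsAxialProfile G G₁ G₂) (h1 : G₁ 1 = 0) : scaledMeanCurvature n G G₁ G₂ 1 = 1 := by
  have h0 := (hG.pos 1 one_mem_Icc_neg_one).ne'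
  have hn0 : (n : ℝ) ≠ 0 := by positivity
  rw [scaledMeanCurvature, curvatureSum, parallelCurvature, meridianCurvature, axialSpeed_one hG h1,
    h1]
  field_simp
  ring

/-- Each term of the derivative at `u = 1` contains `G₁ 1`, `G₂ 1` or the factor `1 - u²`. The last
of these multiplies `G₃`, so no condition on the third derivative is needed. -/
theorem hasDerivWithinAt_scaledMeanCurvature_one (n : ℕ) {G G₁ G₂ : ℝ → ℝ} {G₃ : ℝ}
    (hG : IsAxialProfile G G₁ G₂) (h1 : G₁ 1 = 0) (h2 : G₂ 1 = 0)
    (hG₂ : HasDerivWithinAt G₂ G₃ (Icc (-1) 1) 1) :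
    HasDerivWithinAt (scaledMeanCurvature n G G₁ G₂) 0 (Icc (-1) 1) 1 := by
  have hm := one_mem_Icc_neg_one
  have d0 := hG.hasDeriv 1 hm
  have d1 := hG.hasDeriv_one 1 hm
  have dW := hG.hasDeriv_speed hm
  have hp := hG.pos 1 hm
  have hW := hG.speed_pos hm
  have did : HasDerivWithinAt (fun u : ℝ => u) 1 (Icc (-1) 1) 1 := hasDerivWithinAt_id _ _
  have ds : HasDerivWithinAt (fun u : ℝ => 1 - u ^ 2) (-(2 * 1)) (Icc (-1) 1) 1 := by
    simpa using ((hasDerivAt_pow 2 (1 : ℝ)).const_sub 1).hasDerivWithinAt (s := Icc (-1 : ℝ) 1)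
  have dpar := (d0.fun_add (did.fun_mul d1)).fun_div (d0.fun_mul dW) (mul_pos hp hW).ne'
  have dmer := (((d0.fun_pow 2).fun_add ((ds.fun_mul (d1.fun_pow 2)).const_mul 2)).fun_sub
      (d0.fun_mul ((ds.fun_mul hG₂).fun_sub (did.fun_mul d1)))).fun_div (dW.fun_pow 3)
      (pow_pos hW 3).ne'
  refine (((dpar.const_mul ((n : ℝ) - 1)).fun_add dmer).const_mul (G 1 / n)).congr_deriv ?_
  simp [h1, h2]

/-! ### Admissible perturbation parameters -/

section Admissible

variable {h h₁ h₂ h₃ : ℝ → ℝ}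

theorem HasCosDerivs.isAxialProfile (H : HasCosDerivs h h₁ h₂ h₃) {ε : ℝ}
    (hpos : ∀ u ∈ Icc (-1 : ℝ) 1, 0 < cosProfile h ε u) :
    IsAxialProfile (cosProfile h ε) (cosDeriv h₁ ε) (cosDeriv h₂ ε) where
  pos := hpos
  smooth := contDiffOn_const.add (contDiffOn_const.mul H.base.contDiffOn_comp_arccos)
  smooth_one := contDiffOn_const.mul H.one.contDiffOn_comp_arccos
  hasDeriv _ hu := ((hasDerivWithinAt_comp_arccos H.base H.one H.deriv_base hu).const_mul ε).const_add 1
  hasDeriv_one _ hu := (hasDerivWithinAt_comp_arccos H.one H.two H.deriv_one hu).const_mul ε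

/-- The parameters `ε` for which the hypersurface of profile `1 + ε h` is embedded, radially monotone
from its south pole, and of mean curvature within `δ` of that of the sphere. -/
structure IsAdmissible (n : ℕ) (h h₁ h₂ : ℝ → ℝ) (δ ε : ℝ) : Prop where
  pos : ∀ u ∈ Icc (-1 : ℝ) 1, 0 < cosProfile h ε u
  deriv_pos : ∀ u ∈ Icc (-1 : ℝ) 1, 0 < poleDistSqDeriv (cosProfile h ε) (cosDeriv h₁ ε) u
  close : ∀ u ∈ Icc (-1 : ℝ) 1,
    |scaledMeanCurvature n (cosProfile h ε) (cosDeriv h₁ ε) (cosDeriv h₂ ε) u - 1| < δ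

/-- At `ε = 0` the surface is the unit sphere: profile 1, derivative of the squared pole distance 2,
curvature 1. The three strict inequalities persist by joint continuity in `(ε, u)`. -/
theorem eventually_isAdmissible {n : ℕ} (hn : 1 ≤ n) (H : HasCosDerivs h h₁ h₂ h₃) {δ : ℝ}
    (hδ : 0 < δ) : ∀ᶠ ε in 𝓝 (0 : ℝ), IsAdmissible n h h₁ h₂ δ ε := by
  have hn0 : (n : ℝ) ≠ 0 := by positivity
  have hac := Real.continuous_arccos
  have hc := H.base.smooth.continuous
  have hc1 := H.one.smooth.continuous
  have hc2 := H.two.smooth.continuous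
  have cG : Continuous fun z : ℝ × ℝ => cosProfile h z.1 z.2 := by
    unfold cosProfile; fun_prop
  have cGm : Continuous fun z : ℝ × ℝ => cosProfile h z.1 (-1) := by
    unfold cosProfile; fun_prop
  have cGp : Continuous fun z : ℝ × ℝ => cosProfile h z.1 1 := by
    unfold cosProfile; fun_prop
  have cG1 : Continuous fun z : ℝ × ℝ => cosDeriv h₁ z.1 z.2 := by
    unfold cosDeriv; fun_prop
  have cG2 : Continuous fun z : ℝ × ℝ => cosDeriv h₂ z.1 z.2 := by
    unfold cosDeriv; fun_prop
  have cW : Continuous fun z : ℝ × ℝ => axialSpeed (cosProfile h z.1) (cosDeriv h₁ z.1) z.2 := by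
    unfold axialSpeed; fun_prop
  have e0 : ∀ u, cosProfile h 0 u = 1 := fun u => by simp [cosProfile]
  have e1 : ∀ (k : ℝ → ℝ) u, cosDeriv k 0 u = 0 := fun k u => by simp [cosDeriv]
  have eW : ∀ u, axialSpeed (cosProfile h 0) (cosDeriv h₁ 0) u = 1 := fun u => by
    simp [axialSpeed, e0, e1]
  -- Tube lemma over the compact `[-1, 1]`. The local statements are available at every real `u`,
  -- since `arccos` is continuous on all of `ℝ`.
  have tube : ∀ {P : ℝ → ℝ → Prop}, (∀ u, ∀ᶠ z : ℝ × ℝ in 𝓝 (0, u), P z.1 z.2) →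
      ∀ᶠ ε in 𝓝 (0 : ℝ), ∀ u ∈ Icc (-1 : ℝ) 1, P ε u := fun hP =>
    isCompact_Icc.eventually_forall_of_forall_eventually fun u _ => hP u
  have t1 : ∀ᶠ ε in 𝓝 (0 : ℝ), ∀ u ∈ Icc (-1 : ℝ) 1, 0 < cosProfile h ε u :=
    tube fun u => cG.continuousAt.eventually_const_lt (by simp [e0])
  have t2 : ∀ᶠ ε in 𝓝 (0 : ℝ), ∀ u ∈ Icc (-1 : ℝ) 1,
      0 < poleDistSqDeriv (cosProfile h ε) (cosDeriv h₁ ε) u := by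
    refine tube fun u => ?_
    have c : Continuous fun z : ℝ × ℝ =>
        poleDistSqDeriv (cosProfile h z.1) (cosDeriv h₁ z.1) z.2 := by
      unfold poleDistSqDeriv; fun_prop
    exact c.continuousAt.eventually_const_lt (by simp [poleDistSqDeriv, e0, e1])
  have t3 : ∀ᶠ ε in 𝓝 (0 : ℝ), ∀ u ∈ Icc (-1 : ℝ) 1,
      |scaledMeanCurvature n (cosProfile h ε) (cosDeriv h₁ ε) (cosDeriv h₂ ε) u - 1| < δ := by
    refine tube fun u => ?_
    have c : ContinuousAt (fun z : ℝ × ℝ => |scaledMeanCurvature n (cosProfile h z.1)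
        (cosDeriv h₁ z.1) (cosDeriv h₂ z.1) z.2 - 1|) (0, u) := by
      unfold scaledMeanCurvature curvatureSum parallelCurvature meridianCurvature
      have w1 : cosProfile h (0 : ℝ) u *
          axialSpeed (cosProfile h 0) (cosDeriv h₁ 0) u ≠ 0 := by simp [e0, eW]
      have w2 : axialSpeed (cosProfile h 0) (cosDeriv h₁ 0) u ^ 3 ≠ 0 := by simp [eW]
      have p1 : ContinuousAt (fun z : ℝ × ℝ => (cosProfile h z.1 z.2 + z.2 * cosDeriv h₁ z.1 z.2) /
          (cosProfile h z.1 z.2 * axialSpeed (cosProfile h z.1) (cosDeriv h₁ z.1) z.2)) (0, u) :=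
        ContinuousAt.div (by fun_prop) (by fun_prop) w1
      have p2 : ContinuousAt (fun z : ℝ × ℝ => (cosProfile h z.1 z.2 ^ 2 +
          2 * ((1 - z.2 ^ 2) * cosDeriv h₁ z.1 z.2 ^ 2) - cosProfile h z.1 z.2 *
            ((1 - z.2 ^ 2) * cosDeriv h₂ z.1 z.2 - z.2 * cosDeriv h₁ z.1 z.2)) /
          axialSpeed (cosProfile h z.1) (cosDeriv h₁ z.1) z.2 ^ 3) (0, u) :=
        ContinuousAt.div (by fun_prop) (cW.pow 3).continuousAt w2
      exact ((((cGp.continuousAt.div_const _).mul ((continuousAt_const.mul p1).add p2)).sub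
        continuousAt_const)).abs
    refine c.eventually_lt_const ?_
    simp only [scaledMeanCurvature, curvatureSum, parallelCurvature, meridianCurvature, e0, e1, eW]
    have : (1 : ℝ) / n * ((n - 1) * ((1 + u * 0) / (1 * 1)) +
        (1 ^ 2 + 2 * ((1 - u ^ 2) * 0 ^ 2) - 1 * ((1 - u ^ 2) * 0 - u * 0)) / 1 ^ 3) - 1 = 0 := by
      field_simp; ring
    rw [this, abs_zero]
    exact hδ
  filter_upwards [t1, t2, t3] with ε a1 a2 a3 using ⟨a1, a2, a3⟩

end Admissible

/-! ### The blocks -/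

section Block

variable {h h₁ h₂ h₃ : ℝ → ℝ} {n : ℕ} {δ ε : ℝ}

theorem profile_eq_cosProfile {t : ℝ} (ht : t ∈ Icc 0 Real.pi) :
    profile h ε t = cosProfile h ε (Real.cos t) := by
  rw [profile, cosProfile, Real.arccos_cos ht.1 ht.2]

theorem profile_zero : profile h ε 0 = cosProfile h ε 1 := by
  rw [profile, cosProfile, Real.arccos_one]

theorem profile_pi : profile h ε Real.pi = cosProfile h ε (-1) := by
  rw [profile, cosProfile, Real.arccos_neg_one]

theorem norm_profileCurve_sq {t : ℝ} (ht : t ∈ Icc 0 Real.pi) :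
    ‖profileCurve (profile h ε) t‖ ^ 2 = poleDistSq (cosProfile h ε) (Real.cos t) := by
  rw [EuclideanSpace.norm_sq_eq, Fin.sum_univ_two]
  simp only [profileCurve, Real.norm_eq_abs, sq_abs, PiLp.toLp_apply, Matrix.cons_val_zero,
    Matrix.cons_val_one, profile_pi, profile_eq_cosProfile ht, poleDistSq]
  linear_combination (cosProfile h ε (Real.cos t)) ^ 2 * Real.sin_sq_add_cos_sq t

theorem sum_principalCurvature (hn : 1 ≤ n) (H : HasCosDerivs h h₁ h₂ h₃) {t : ℝ}
    (ht : t ∈ Icc 0 Real.pi) :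
    ∑ i : Fin n, principalCurvature n (profile h ε) i t =
      curvatureSum n (cosProfile h ε) (cosDeriv h₁ ε) (cosDeriv h₂ ε) (Real.cos t) := by
  have hd : deriv (profile h ε) = fun t => ε * deriv h t := funext fun t =>
    (((H.base.hasDerivAt t).const_mul ε).const_add 1).deriv
  have hdt : deriv (profile h ε) t = ε * -(Real.sin t * h₁ t) := by rw [hd, ← H.deriv_base]
  have hd2 : deriv (deriv (profile h ε)) t = ε * deriv (deriv h) t := by
    rw [hd]
    exact (((contDiff_infty_iff_deriv.1 H.base.smooth).2.differentiable (by simp) t).hasDerivAt.const_mul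
      ε).deriv
  have e0 := profile_eq_cosProfile (h := h) (ε := ε) ht
  have e1 : cosDeriv h₁ ε (Real.cos t) = ε * h₁ t := by rw [cosDeriv, Real.arccos_cos ht.1 ht.2]
  have e2 : cosDeriv h₂ ε (Real.cos t) = ε * h₂ t := by rw [cosDeriv, Real.arccos_cos ht.1 ht.2]
  have esin : 1 - Real.cos t ^ 2 = Real.sin t ^ 2 := by rw [← Real.sin_sq_add_cos_sq t]; ring
  have eW : √(profile h ε t ^ 2 + deriv (profile h ε) t ^ 2) =
      axialSpeed (cosProfile h ε) (cosDeriv h₁ ε) (Real.cos t) := by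
    rw [axialSpeed, e0, e1, esin, hdt]
    ring_nf
  have hcot : Real.cos t / Real.sin t * deriv (profile h ε) t =
      -(Real.cos t * (ε * h₁ t)) := by
    rw [hdt]
    -- At the poles the left side is 0 by the convention `x / 0 = 0`, and the right side is 0
    -- because `h₁` vanishes there. The condition `h''(π) = 0` enters here, as `one_pi`.
    rcases ht.1.eq_or_lt with rfl | h0
    · simp [H.one_zero]
    rcases ht.2.eq_or_lt with rfl | h1
    · simp [H.one_pi]
    have := (Real.sin_pos_of_pos_of_lt_pi h0 h1).ne'
    field_simp
  obtain ⟨m, rfl⟩ : ∃ m, n = m + 1 := ⟨n - 1, by omega⟩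
  have hpar : ∀ i : Fin m, principalCurvature (m + 1) (profile h ε) i.castSucc t =
      parallelCurvature (cosProfile h ε) (cosDeriv h₁ ε) (Real.cos t) := by
    intro i
    have hi : ((i.castSucc : Fin (m + 1)) : ℕ) + 1 ≠ m + 1 := by
      have := i.isLt
      rw [Fin.val_castSucc]
      omega
    rw [principalCurvature, if_neg hi, hcot, eW, parallelCurvature, e0, e1]
    ring
  rw [Fin.sum_univ_castSucc, Finset.sum_congr rfl fun i _ => hpar i, Finset.sum_const,
    Finset.card_univ, Fintype.card_fin, nsmul_eq_mul, curvatureSum]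
  congr 1
  · push_cast; ring
  · rw [principalCurvature, if_pos (by simp), eW, meridianCurvature, hd2,
      deriv_deriv_of_cos H.one H.deriv_base H.deriv_one, e0, e1, e2, esin, hdt]
    ring

namespace IsAdmissible

theorem pos_one (A : IsAdmissible n h h₁ h₂ δ ε) : 0 < cosProfile h ε 1 :=
  A.pos 1 one_mem_Icc_neg_one

theorem pos_neg_one (A : IsAdmissible n h h₁ h₂ δ ε) : 0 < cosProfile h ε (-1) :=
  A.pos (-1) (by norm_num)

theorem blockRadius_pos (A : IsAdmissible n h h₁ h₂ δ ε) : 0 < blockRadius h ε := by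
  rw [blockRadius, profile_zero, profile_pi]
  exact div_pos (add_pos A.pos_one A.pos_neg_one) A.pos_one

theorem norm_le_blockRadius_iff (A : IsAdmissible n h h₁ h₂ δ ε)
    (q : EuclideanSpace ℝ (Fin (n + 1))) :
    ‖q‖ ≤ blockRadius h ε ↔ (cosProfile h ε 1 * ‖q‖) ^ 2 ≤ poleDistSq (cosProfile h ε) 1 := by
  rw [blockRadius, profile_zero, profile_pi, le_div_iff₀ A.pos_one, mul_comm, poleDistSq_one,
    pow_le_pow_iff_left₀ (mul_nonneg A.pos_one.le (norm_nonneg q))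
      (add_pos A.pos_one A.pos_neg_one).le two_ne_zero]

theorem exists_inverse (A : IsAdmissible n h h₁ h₂ δ ε) (H : HasCosDerivs h h₁ h₂ h₃) :
    StrictMonoOn (poleDistSq (cosProfile h ε)) (Icc (-1) 1) ∧
      poleDistSq (cosProfile h ε) '' Icc (-1) 1 =
        Icc (poleDistSq (cosProfile h ε) (-1)) (poleDistSq (cosProfile h ε) 1) ∧
      ∃ σ : ℝ → ℝ,
        MapsTo σ (Icc (poleDistSq (cosProfile h ε) (-1)) (poleDistSq (cosProfile h ε) 1))
          (Icc (-1) 1) ∧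
        (∀ y ∈ Icc (poleDistSq (cosProfile h ε) (-1)) (poleDistSq (cosProfile h ε) 1),
          poleDistSq (cosProfile h ε) (σ y) = y) ∧
        (∀ u ∈ Icc (-1 : ℝ) 1, σ (poleDistSq (cosProfile h ε) u) = u) ∧
        ContDiffOn ℝ ∞ σ
          (Icc (poleDistSq (cosProfile h ε) (-1)) (poleDistSq (cosProfile h ε) 1)) ∧
        ∀ y ∈ Icc (poleDistSq (cosProfile h ε) (-1)) (poleDistSq (cosProfile h ε) 1),
          HasDerivWithinAt σ (poleDistSqDeriv (cosProfile h ε) (cosDeriv h₁ ε) (σ y))⁻¹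
            (Icc (poleDistSq (cosProfile h ε) (-1)) (poleDistSq (cosProfile h ε) 1)) y :=
  exists_contDiffOn_inverse_Icc (by norm_num : (-1 : ℝ) < 1)
    (contDiffOn_poleDistSq (H.isAxialProfile A.pos))
    (fun _ hu => hasDerivWithinAt_poleDistSq (H.isAxialProfile A.pos) hu) A.deriv_pos

theorem profileAngle_eq (A : IsAdmissible n h h₁ h₂ δ ε) (H : HasCosDerivs h h₁ h₂ h₃) {t r : ℝ}
    (ht : t ∈ Icc 0 Real.pi) (hr : 0 ≤ r)
    (h_eq : r ^ 2 = poleDistSq (cosProfile h ε) (Real.cos t)) :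
    profileAngle (profile h ε) r = t := by
  have hr' : r = ‖profileCurve (profile h ε) t‖ := by
    rw [← norm_profileCurve_sq ht] at h_eq
    exact (pow_left_inj₀ hr (norm_nonneg _) two_ne_zero).1 h_eq
  have hinj : InjOn (fun t => ‖profileCurve (profile h ε) t‖) (Icc 0 Real.pi) := by
    intro a ha b hb hab
    have hab' : poleDistSq (cosProfile h ε) (Real.cos a) =
        poleDistSq (cosProfile h ε) (Real.cos b) := by
      rw [← norm_profileCurve_sq ha, ← norm_profileCurve_sq hb]
      exact congrArg (· ^ 2) hab
    exact Real.injOn_cos ha hb ((A.exists_inverse H).1.injOn (Real.cos_mem_Icc a)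
      (Real.cos_mem_Icc b) hab')
  rw [hr']
  exact hinj.leftInvOn_invFunOn ht

/-- The block in terms of the cosine of the polar angle. -/
theorem block_eq (A : IsAdmissible n h h₁ h₂ δ ε) (hn : 1 ≤ n) (H : HasCosDerivs h h₁ h₂ h₃)
    {q : EuclideanSpace ℝ (Fin (n + 1))} {u : ℝ} (hu : u ∈ Icc (-1 : ℝ) 1)
    (h_eq : (cosProfile h ε 1 * ‖q‖) ^ 2 = poleDistSq (cosProfile h ε) u) :
    block n h ε q =
      scaledMeanCurvature n (cosProfile h ε) (cosDeriv h₁ ε) (cosDeriv h₂ ε) u := by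
  have hq : ‖q‖ ≤ blockRadius h ε := by
    rw [A.norm_le_blockRadius_iff, h_eq]
    exact (A.exists_inverse H).1.monotoneOn hu one_mem_Icc_neg_one hu.2
  have hcos := Real.cos_arccos hu.1 hu.2
  have ht : Real.arccos u ∈ Icc 0 Real.pi := ⟨Real.arccos_nonneg u, Real.arccos_le_pi u⟩
  rw [block, if_pos hq, profile_zero, A.profileAngle_eq H ht
    (mul_nonneg A.pos_one.le (norm_nonneg q)) (by rw [h_eq, hcos]), sum_principalCurvature hn H ht,
    hcos, scaledMeanCurvature]

theorem exists_cos (A : IsAdmissible n h h₁ h₂ δ ε) (H : HasCosDerivs h h₁ h₂ h₃)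
    {q : EuclideanSpace ℝ (Fin (n + 1))} (hq : ‖q‖ ≤ blockRadius h ε) :
    ∃ u ∈ Icc (-1 : ℝ) 1, (cosProfile h ε 1 * ‖q‖) ^ 2 = poleDistSq (cosProfile h ε) u := by
  have h1 : (cosProfile h ε 1 * ‖q‖) ^ 2 ∈ Icc (poleDistSq (cosProfile h ε) (-1))
      (poleDistSq (cosProfile h ε) 1) :=
    ⟨by rw [poleDistSq_neg_one]; positivity, (A.norm_le_blockRadius_iff q).1 hq⟩
  rw [← (A.exists_inverse H).2.1] at h1
  obtain ⟨u, hu, hu'⟩ := h1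
  exact ⟨u, hu, hu'.symm⟩

theorem cosDeriv_one (H : HasCosDerivs h h₁ h₂ h₃) : cosDeriv h₁ ε 1 = 0 := by
  rw [cosDeriv, Real.arccos_one, H.one_zero, mul_zero]

theorem block_eq_one (A : IsAdmissible n h h₁ h₂ δ ε) (hn : 1 ≤ n) (H : HasCosDerivs h h₁ h₂ h₃)
    {q : EuclideanSpace ℝ (Fin (n + 1))} (hq : blockRadius h ε ≤ ‖q‖) : block n h ε q = 1 := by
  rcases hq.eq_or_lt with hq | hq
  · rw [A.block_eq hn H one_mem_Icc_neg_one,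
      scaledMeanCurvature_one hn (H.isAxialProfile A.pos) (cosDeriv_one H)]
    rw [← hq, blockRadius, profile_zero, profile_pi, poleDistSq_one,
      mul_div_cancel₀ _ A.pos_one.ne']
  · rw [block, if_neg (not_le.2 hq)]

theorem abs_block_sub_one_lt (A : IsAdmissible n h h₁ h₂ δ ε) (hn : 1 ≤ n)
    (H : HasCosDerivs h h₁ h₂ h₃) (hδ : 0 < δ) (q : EuclideanSpace ℝ (Fin (n + 1))) :
    |block n h ε q - 1| < δ := by
  rcases le_total ‖q‖ (blockRadius h ε) with hq | hq
  · obtain ⟨u, hu, hqu⟩ := A.exists_cos H hq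
    rw [A.block_eq hn H hu hqu]
    exact A.close u hu
  · rw [A.block_eq_one hn H hq]
    simpa using hδ

/-- The block is a one-variable function composed with `cosProfile h ε 1 ^ 2 * ‖q‖ ^ 2`. This is
smooth even at the origin, so only the regularity of the one-variable function on a closed half-line
matters. -/
theorem contDiff_block_of_radial (A : IsAdmissible n h h₁ h₂ δ ε) (hn : 1 ≤ n)
    (H : HasCosDerivs h h₁ h₂ h₃) {k : WithTop ℕ∞} {σ : ℝ → ℝ}
    (hmaps : MapsTo σ (Icc (poleDistSq (cosProfile h ε) (-1)) (poleDistSq (cosProfile h ε) 1))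
      (Icc (-1) 1))
    (hσ : ∀ y ∈ Icc (poleDistSq (cosProfile h ε) (-1)) (poleDistSq (cosProfile h ε) 1),
      poleDistSq (cosProfile h ε) (σ y) = y)
    (hF : ContDiffOn ℝ k (fun y => if y ≤ poleDistSq (cosProfile h ε) 1 then
      scaledMeanCurvature n (cosProfile h ε) (cosDeriv h₁ ε) (cosDeriv h₂ ε) (σ y) else 1)
      (Ici (poleDistSq (cosProfile h ε) (-1)))) :
    ContDiff ℝ k (block n h ε) := by
  have hq : ContDiff ℝ k fun q : EuclideanSpace ℝ (Fin (n + 1)) =>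
      cosProfile h ε 1 ^ 2 * ‖q‖ ^ 2 := contDiff_const.mul (contDiff_norm_sq ℝ)
  have hmem : ∀ q : EuclideanSpace ℝ (Fin (n + 1)),
      poleDistSq (cosProfile h ε) (-1) ≤ cosProfile h ε 1 ^ 2 * ‖q‖ ^ 2 := fun q => by
    rw [poleDistSq_neg_one]; positivity
  have hcomp := hF.comp (contDiffOn_univ.2 hq) fun q _ => hmem q
  rw [contDiffOn_univ] at hcomp
  convert hcomp using 1
  funext q
  simp only [Function.comp_apply, ← mul_pow, ← A.norm_le_blockRadius_iff q]
  split_ifs with hle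
  · have hy : (cosProfile h ε 1 * ‖q‖) ^ 2 ∈ Icc (poleDistSq (cosProfile h ε) (-1))
        (poleDistSq (cosProfile h ε) 1) :=
      ⟨mul_pow (cosProfile h ε 1) ‖q‖ 2 ▸ hmem q, (A.norm_le_blockRadius_iff q).1 hle⟩
    exact A.block_eq hn H (hmaps hy) (hσ _ hy).symm
  · exact A.block_eq_one hn H (not_le.1 hle).le

theorem contDiff_one_block (A : IsAdmissible n h h₁ h₂ δ ε) (hn : 1 ≤ n)
    (H : HasCosDerivs h h₁ h₂ h₃) : ContDiff ℝ 1 (block n h ε) := by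
  obtain ⟨hmono, -, σ, hmaps, hright, hleft, hsmooth, hderiv⟩ := A.exists_inverse H
  have hm := one_mem_Icc_neg_one
  have hlt : poleDistSq (cosProfile h ε) (-1) < poleDistSq (cosProfile h ε) 1 :=
    hmono (by norm_num) hm (by norm_num)
  have hS := right_mem_Icc.2 hlt.le
  have hG := H.isAxialProfile A.pos
  have hf : ContDiffOn ℝ ∞
      (scaledMeanCurvature n (cosProfile h ε) (cosDeriv h₁ ε) (cosDeriv h₂ ε)) (Icc (-1) 1) :=
    contDiffOn_scaledMeanCurvature n hG (contDiffOn_const.mul H.two.contDiffOn_comp_arccos)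
  refine A.contDiff_block_of_radial hn H hmaps hright
    (contDiffOn_one_ite_Icc hlt ((hf.comp hsmooth hmaps).of_le (by exact_mod_cast le_top)) ?_ ?_)
  · rw [hleft 1 hm, scaledMeanCurvature_one hn hG (cosDeriv_one H)]
  · have h0 : HasDerivWithinAt
        (scaledMeanCurvature n (cosProfile h ε) (cosDeriv h₁ ε) (cosDeriv h₂ ε)) 0 (Icc (-1) 1)
        (σ (poleDistSq (cosProfile h ε) 1)) := by
      rw [hleft 1 hm]
      refine hasDerivWithinAt_scaledMeanCurvature_one n hG (cosDeriv_one H) ?_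
        ((hasDerivWithinAt_comp_arccos H.two H.three H.deriv_two hm).const_mul ε)
      rw [cosDeriv, Real.arccos_one, H.two_zero, mul_zero]
    exact (h0.comp _ (hderiv _ hS) hmaps).congr_deriv (zero_mul _)

/-- If `h` vanishes near 0, so do `h₁` and `h₂`: divide by the sine away from 0, and use the pole
conditions at 0. The surface is then exactly round near its north pole, and the block is constantly
1 near its outer radius. -/
theorem contDiff_infty_block (A : IsAdmissible n h h₁ h₂ δ ε) (hn : 1 ≤ n)
    (H : HasCosDerivs h h₁ h₂ h₃) (hflat : ∀ᶠ t in 𝓝 (0 : ℝ), h t = 0) :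
    ContDiff ℝ ∞ (block n h ε) := by
  obtain ⟨hmono, -, σ, hmaps, hright, hleft, hsmooth, hderiv⟩ := A.exists_inverse H
  have hm := one_mem_Icc_neg_one
  have hlt : poleDistSq (cosProfile h ε) (-1) < poleDistSq (cosProfile h ε) 1 :=
    hmono (by norm_num) hm (by norm_num)
  have hS := right_mem_Icc.2 hlt.le
  have hG := H.isAxialProfile A.pos
  have hf : ContDiffOn ℝ ∞
      (scaledMeanCurvature n (cosProfile h ε) (cosDeriv h₁ ε) (cosDeriv h₂ ε)) (Icc (-1) 1) :=
    contDiffOn_scaledMeanCurvature n hG (contDiffOn_const.mul H.two.contDiffOn_comp_arccos)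
  refine A.contDiff_block_of_radial hn H hmaps hright
    (contDiffOn_ite_Icc (hf.comp hsmooth hmaps) ?_ hlt)
  have d1 : ∀ᶠ t in 𝓝 (0 : ℝ), deriv h t = 0 := by
    filter_upwards [hflat.eventually_nhds] with t ht
    have ht' : h =ᶠ[𝓝 t] fun _ => (0 : ℝ) := ht
    rw [ht'.deriv_eq, deriv_const]
  have d2 : ∀ᶠ t in 𝓝 (0 : ℝ), deriv (deriv h) t = 0 := by
    filter_upwards [d1.eventually_nhds] with t ht
    have ht' : deriv h =ᶠ[𝓝 t] fun _ => (0 : ℝ) := ht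
    rw [ht'.deriv_eq, deriv_const]
  have hsin : ∀ᶠ t in 𝓝 (0 : ℝ), t ∈ Ioo (-Real.pi) Real.pi :=
    Ioo_mem_nhds (by linarith [Real.pi_pos]) Real.pi_pos
  have hall : ∀ᶠ t in 𝓝 (0 : ℝ), h t = 0 ∧ h₁ t = 0 ∧ h₂ t = 0 := by
    filter_upwards [hflat, d1, d2, hsin] with t a0 a1 a2 a3
    rcases eq_or_ne t 0 with rfl | ht
    · exact ⟨a0, H.one_zero, H.two_zero⟩
    have hs : Real.sin t ≠ 0 := by
      rcases lt_or_gt_of_ne ht with h0 | h0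
      · exact (Real.sin_neg_of_neg_of_neg_pi_lt h0 a3.1).ne
      · exact (Real.sin_pos_of_pos_of_lt_pi h0 a3.2).ne'
    have b1 : h₁ t = 0 := by
      rw [H.deriv_base, neg_eq_zero] at a1
      exact (mul_eq_zero.1 a1).resolve_left hs
    rw [deriv_deriv_of_cos H.one H.deriv_base H.deriv_one, b1, mul_zero, sub_zero] at a2
    exact ⟨a0, b1, (mul_eq_zero.1 a2).resolve_left (pow_ne_zero 2 hs)⟩
  have hcont : Tendsto (fun y => Real.arccos (σ y))
      (𝓝[Icc (poleDistSq (cosProfile h ε) (-1)) (poleDistSq (cosProfile h ε) 1)]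
        (poleDistSq (cosProfile h ε) 1)) (𝓝 0) := by
    have := (Real.continuous_arccos.continuousAt (x := σ (poleDistSq (cosProfile h ε) 1))).tendsto.comp
      (hsmooth.continuousOn _ hS)
    rwa [hleft 1 hm, Real.arccos_one] at this
  have hn0 : (n : ℝ) ≠ 0 := by positivity
  have h10 : cosProfile h ε 1 = 1 := by
    rw [cosProfile, Real.arccos_one, hflat.self_of_nhds, mul_zero, add_zero]
  filter_upwards [hcont.eventually hall] with y ⟨b0, b1, b2⟩
  have c0 : cosProfile h ε (σ y) = 1 := by rw [cosProfile, b0, mul_zero, add_zero]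
  have c1 : cosDeriv h₁ ε (σ y) = 0 := by rw [cosDeriv, b1, mul_zero]
  have c2 : cosDeriv h₂ ε (σ y) = 0 := by rw [cosDeriv, b2, mul_zero]
  simp only [scaledMeanCurvature, curvatureSum, parallelCurvature,
    meridianCurvature, axialSpeed, c0, c1, c2, h10]
  simp
  field_simp

/-! ### The bubbles -/

/-- The distance to the centre `p` determines the height on the surface; this is what matches the
surface's curvature with the radial block. -/
theorem norm_revolutionMap_sub_sq (A : IsAdmissible n h h₁ h₂ δ ε)
    (p : EuclideanSpace ℝ (Fin (n + 1))) {e : EuclideanSpace ℝ (Fin (n + 1))} (he : ‖e‖ = 1)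
    (x : UnitSphere n) :
    (cosProfile h ε 1 * ‖revolutionMap (cosProfile h ε) (cosProfile h ε 1) (cosProfile h ε (-1)) p e x
      - p‖) ^ 2 = poleDistSq (cosProfile h ε) (height e x) := by
  have hx : ‖(x : EuclideanSpace ℝ (Fin (n + 1)))‖ = 1 := norm_eq_of_mem_sphere x
  have h0 := A.pos_one.ne'
  rw [revolutionMap, add_sub_cancel_left, mul_pow, norm_add_sq_real, norm_smul, norm_smul, hx, he,
    inner_smul_left, inner_smul_right, ← show height e x = inner ℝ (x : EuclideanSpace ℝ (Fin (n + 1))) e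
      from rfl, poleDistSq]
  simp only [mul_one, Real.norm_eq_abs, sq_abs, conj_trivial]
  field_simp
  ring

/-- Bubbles fill the ball of a block. -/
theorem exists_isBubble (A : IsAdmissible n h h₁ h₂ δ ε) (hn : 1 ≤ n) (H : HasCosDerivs h h₁ h₂ h₃)
    {K : EuclideanSpace ℝ (Fin (n + 1)) → ℝ} {p q : EuclideanSpace ℝ (Fin (n + 1))}
    (hK : ∀ y, ‖y - p‖ ≤ blockRadius h ε → K y = block n h ε (y - p))
    (hq : ‖q - p‖ ≤ blockRadius h ε) : ∃ S, IsBubble K S ∧ q ∈ S := by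
  obtain ⟨u, hu, hqu⟩ := A.exists_cos H hq
  have hG := H.isAxialProfile A.pos
  let E := EuclideanSpace ℝ (Fin (n + 1))
  -- a pair of unit vectors with inner product `u`
  let b : OrthonormalBasis (Fin (n + 1)) ℝ E := EuclideanSpace.basisFun _ ℝ
  have h01 : (0 : Fin (n + 1)) ≠ Fin.last n := by
    rw [Ne, Fin.ext_iff]; simp; omega
  let e₀ : E := b 0
  let x₀ : E := u • b 0 + √(1 - u ^ 2) • b (Fin.last n)
  have hu2 : 0 ≤ 1 - u ^ 2 := by nlinarith [hu.1, hu.2]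
  have he₀ : ‖e₀‖ = 1 := b.norm_eq_one 0
  have hb01 : inner ℝ (b 0) (b (Fin.last n)) = 0 := b.orthonormal.2 h01
  have hx₀ : ‖x₀‖ = 1 := by
    have : ‖x₀‖ ^ 2 = 1 := by
      simp only [x₀]
      rw [norm_add_sq_real, norm_smul, norm_smul, b.norm_eq_one, b.norm_eq_one, inner_smul_left,
        inner_smul_right, hb01]
      simp only [mul_one, mul_zero, add_zero, Real.norm_eq_abs, sq_abs, Real.sq_sqrt hu2]
      ring
    nlinarith [norm_nonneg x₀]
  have hxe : inner ℝ x₀ e₀ = u := by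
    simp only [x₀, e₀, inner_add_left, inner_smul_left, real_inner_comm (b 0) (b (Fin.last n)), hb01]
    simp [b.norm_eq_one]
  let X₀ : UnitSphere n := ⟨x₀, by simpa using hx₀⟩
  have hheight : height e₀ X₀ = u := hxe
  let v₀ : E := revolutionMap (cosProfile h ε) (cosProfile h ε 1) (cosProfile h ε (-1)) 0 e₀ X₀
  have hv₀ : ‖v₀‖ = ‖q - p‖ := by
    have h1 := A.norm_revolutionMap_sub_sq 0 he₀ X₀
    rw [sub_zero, hheight, ← hqu] at h1
    have h2 := (pow_left_inj₀ (mul_nonneg A.pos_one.le (norm_nonneg _))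
      (mul_nonneg A.pos_one.le (norm_nonneg _)) two_ne_zero).1 h1
    exact mul_left_cancel₀ A.pos_one.ne' h2
  -- The vectors `v₀` and `q - p` have equal norm, so the reflection in the hyperplane orthogonal to
  -- their difference carries one to the other. The wanted bubble is the surface about the reflected
  -- axis.
  let R : E ≃ₗᵢ[ℝ] E := (ℝ ∙ (v₀ - (q - p)))ᗮ.reflection
  have hR : R v₀ = q - p := Submodule.reflection_sub hv₀
  let e : E := R e₀
  have he : ‖e‖ = 1 := by rw [R.norm_map, he₀]
  let X : UnitSphere n := ⟨R x₀, by simp [hx₀]⟩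
  have hXe : height e X = u := by
    simp only [height, X, e]
    rw [R.inner_map_map, hxe]
  refine ⟨_, hG.isBubble_range_revolutionMap hn A.pos_one (cosProfile h ε (-1)) p he fun x => ?_, X, ?_⟩
  · have h1 := A.norm_revolutionMap_sub_sq p he x
    have h2 := height_mem_Icc he x
    rw [hK, A.block_eq hn H h2 h1, scaledMeanCurvature]
    rw [A.norm_le_blockRadius_iff, h1]
    exact (A.exists_inverse H).1.monotoneOn h2 one_mem_Icc_neg_one h2.2
  · rw [revolutionMap, hXe]
    have h1 : R v₀ = (((cosProfile h ε 1)⁻¹ * cosProfile h ε u) • R x₀ +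
        ((cosProfile h ε 1)⁻¹ * cosProfile h ε (-1)) • R e₀) := by
      simp only [v₀, revolutionMap, hheight, zero_add, map_add, map_smul, X₀]
    rw [hR] at h1
    rw [show (X : E) = R x₀ from rfl, show e = R e₀ from rfl, ← h1, add_sub_cancel]

end IsAdmissible

/-- Unit spheres are bubbles where the prescribed curvature is one. -/
theorem isBubble_unitSphere (hn : 1 ≤ n) {K : EuclideanSpace ℝ (Fin (n + 1)) → ℝ}
    {c : EuclideanSpace ℝ (Fin (n + 1))} (hK : ∀ y, ‖y - c‖ = 1 → K y = 1) :
    ∃ S, IsBubble K S ∧ ∀ y, ‖y - c‖ = 1 → y ∈ S := by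
  have hG : IsAxialProfile (fun _ => 1) (fun _ => 0) (fun _ => 0) :=
    ⟨fun _ _ => one_pos, contDiffOn_const, contDiffOn_const,
      fun _ _ => hasDerivWithinAt_const _ _ _, fun _ _ => hasDerivWithinAt_const _ _ _⟩
  let e : EuclideanSpace ℝ (Fin (n + 1)) := EuclideanSpace.basisFun _ ℝ 0
  have he : ‖e‖ = 1 := (EuclideanSpace.basisFun (Fin (n + 1)) ℝ).norm_eq_one 0
  have hmap : ∀ x : UnitSphere n, revolutionMap (fun _ => 1) 1 0 c e x = c + x := fun x => by
    simp [revolutionMap]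
  have hn0 : (n : ℝ) ≠ 0 := by positivity
  refine ⟨_, hG.isBubble_range_revolutionMap hn one_pos 0 c he fun x => ?_, fun y hy => ?_⟩
  · rw [hmap, hK _ (by rw [add_sub_cancel_left]; exact norm_eq_of_mem_sphere x)]
    simp only [curvatureSum, parallelCurvature, meridianCurvature, axialSpeed]
    simp
    field_simp
  · exact ⟨⟨y - c, by simpa using hy⟩, by rw [hmap, add_sub_cancel]⟩

end Block

/-! ### Gluing the blocks -/

section Glued

variable {h h₁ h₂ h₃ : ℝ → ℝ} {n : ℕ} {δ : ℝ} {ε : ℕ → ℝ}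
  {p : ℕ → EuclideanSpace ℝ (Fin (n + 1))}

/-- The case `y = z` makes the gluing unambiguous. The slack 2 moreover shows that a ball of radius
1 meets at most one block, which makes the gluing locally trivial. -/
theorem eq_of_mem_balls (hsep : ∀ i j, i ≠ j →
      blockRadius h (ε i) + blockRadius h (ε j) + 2 ≤ ‖p i - p j‖)
    {y z : EuclideanSpace ℝ (Fin (n + 1))} {i j : ℕ} (hy : ‖y - p i‖ ≤ blockRadius h (ε i))
    (hz : ‖z - p j‖ ≤ blockRadius h (ε j)) (hyz : ‖y - z‖ < 2) : i = j := by
  by_contra hij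
  have h1 := hsep i j hij
  have h2 : ‖p i - p j‖ ≤ ‖y - p i‖ + ‖y - z‖ + ‖z - p j‖ := by
    have e : p i - p j = -(y - p i) + (y - z) + (z - p j) := by abel
    rw [e]
    exact (norm_add₃_le).trans (by rw [norm_neg])
  linarith

theorem glued_eq_block (hsep : ∀ i j, i ≠ j →
      blockRadius h (ε i) + blockRadius h (ε j) + 2 ≤ ‖p i - p j‖)
    {q : EuclideanSpace ℝ (Fin (n + 1))} {j : ℕ} (hq : ‖q - p j‖ ≤ blockRadius h (ε j)) :
    glued n h ε p q = block n h (ε j) (q - p j) := by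
  have hex : ∃ j, ‖q - p j‖ ≤ blockRadius h (ε j) := ⟨j, hq⟩
  have hj : hex.choose = j := eq_of_mem_balls hsep hex.choose_spec hq (by simp)
  rw [glued, dif_pos hex, hj]

theorem glued_eq_one {q : EuclideanSpace ℝ (Fin (n + 1))}
    (hq : ∀ j, ¬‖q - p j‖ ≤ blockRadius h (ε j)) : glued n h ε p q = 1 := by
  rw [glued, dif_neg (not_exists.2 hq)]

/-- Admissibility is required only of a block whose ball contains `q`, so that the limit at infinity
can use a `δ` that just the far indices satisfy. -/
theorem abs_glued_sub_one_lt (hn : 1 ≤ n) (H : HasCosDerivs h h₁ h₂ h₃) (hδ : 0 < δ)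
    {q : EuclideanSpace ℝ (Fin (n + 1))} (hsep : ∀ i j, i ≠ j →
      blockRadius h (ε i) + blockRadius h (ε j) + 2 ≤ ‖p i - p j‖)
    (hA : ∀ j, ‖q - p j‖ ≤ blockRadius h (ε j) → IsAdmissible n h h₁ h₂ δ (ε j)) :
    |glued n h ε p q - 1| < δ := by
  by_cases hq : ∃ j, ‖q - p j‖ ≤ blockRadius h (ε j)
  · obtain ⟨j, hj⟩ := hq
    rw [glued_eq_block hsep hj]
    exact (hA j hj).abs_block_sub_one_lt hn H hδ _
  · rw [glued_eq_one (not_exists.1 hq)]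
    simpa using hδ

variable (hA : ∀ j, IsAdmissible n h h₁ h₂ δ (ε j)) (hn : 1 ≤ n) (H : HasCosDerivs h h₁ h₂ h₃)
  (hsep : ∀ i j, i ≠ j → blockRadius h (ε i) + blockRadius h (ε j) + 2 ≤ ‖p i - p j‖)

include hA hn H hsep

theorem glued_eq_one_of_blockRadius_le {q : EuclideanSpace ℝ (Fin (n + 1))}
    (hq : ∀ j, blockRadius h (ε j) ≤ ‖q - p j‖) : glued n h ε p q = 1 := by
  by_cases hex : ∃ j, ‖q - p j‖ ≤ blockRadius h (ε j)
  · obtain ⟨j, hj⟩ := hex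
    rw [glued_eq_block hsep hj, (hA j).block_eq_one hn H (hq j)]
  · exact glued_eq_one (not_exists.1 hex)

theorem glued_eventuallyEq (q : EuclideanSpace ℝ (Fin (n + 1))) :
    (∃ j, glued n h ε p =ᶠ[𝓝 q] fun y => block n h (ε j) (y - p j)) ∨
      glued n h ε p =ᶠ[𝓝 q] fun _ => 1 := by
  have hball : Metric.ball q 1 ∈ 𝓝 q := Metric.ball_mem_nhds q one_pos
  by_cases hex : ∃ z ∈ Metric.ball q 1, ∃ j, ‖z - p j‖ ≤ blockRadius h (ε j)
  · obtain ⟨z, hz, j, hj⟩ := hex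
    refine Or.inl ⟨j, ?_⟩
    filter_upwards [hball] with y hy
    by_cases hyj : ‖y - p j‖ ≤ blockRadius h (ε j)
    · exact glued_eq_block hsep hyj
    · rw [(hA j).block_eq_one hn H (not_le.1 hyj).le]
      refine glued_eq_one fun i hi => ?_
      have hyz : ‖y - z‖ < 2 := by
        rw [← dist_eq_norm]
        have h1 := dist_triangle_right y z q
        have h2 := Metric.mem_ball.1 hy
        have h3 := Metric.mem_ball.1 hz
        linarith
      have hij := eq_of_mem_balls hsep hi hj hyz
      exact hyj (hij ▸ hi)
  · refine Or.inr ?_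
    filter_upwards [hball] with y hy
    exact glued_eq_one fun i hi => hex ⟨y, hy, i, hi⟩

theorem contDiff_glued {k : WithTop ℕ∞} (hk : ∀ j, ContDiff ℝ k (block n h (ε j))) :
    ContDiff ℝ k (glued n h ε p) := by
  refine contDiff_iff_contDiffAt.2 fun q => ?_
  rcases glued_eventuallyEq hA hn H hsep q with ⟨j, hj⟩ | hq
  · exact (((hk j).comp (contDiff_id.sub contDiff_const)).contDiffAt).congr_of_eventuallyEq hj
  · exact contDiffAt_const.congr_of_eventuallyEq hq

omit H in
/-- Around a point outside the balls there is room for a unit sphere through that point. -/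
theorem exists_center {q : EuclideanSpace ℝ (Fin (n + 1))}
    (hq : ∀ j, blockRadius h (ε j) < ‖q - p j‖) :
    ∃ c, ‖q - c‖ = 1 ∧ ∀ j, blockRadius h (ε j) + 1 ≤ ‖c - p j‖ := by
  by_contra! hcon
  -- A centre on the unit sphere about `q` is unusable exactly when it lies in one of these enlarged
  -- balls.
  let U : ℕ → Set (EuclideanSpace ℝ (Fin (n + 1))) := fun j =>
    Metric.ball (p j) (blockRadius h (ε j) + 1)
  have hcover : ∀ c ∈ Metric.sphere q 1, ∃ j, c ∈ U j := fun c hc => by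
    obtain ⟨j, hj⟩ := hcon c (by rw [← dist_eq_norm, dist_comm]; exact hc)
    exact ⟨j, by rw [Metric.mem_ball, dist_eq_norm]; exact hj⟩
  have hrank : 1 < Module.rank ℝ (EuclideanSpace ℝ (Fin (n + 1))) := by
    rw [← Module.finrank_eq_rank, finrank_euclideanSpace_fin]
    exact_mod_cast Nat.lt_add_of_pos_left hn
  have hconn : IsPreconnected (Metric.sphere q 1) := isPreconnected_sphere hrank q 1
  obtain ⟨c₀, hc₀⟩ : (Metric.sphere q 1).Nonempty := by
    have : Nontrivial (EuclideanSpace ℝ (Fin (n + 1))) := inferInstance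
    exact NormedSpace.sphere_nonempty.2 zero_le_one
  obtain ⟨j, hj⟩ := hcover c₀ hc₀
  -- The separation `ρ_i + ρ_j + 2` is the sum of the enlarged radii, so these open balls are
  -- pairwise disjoint and the connected sphere lies in just one of them.
  have hdisj : Disjoint (U j) (⋃ i ∈ {i | i ≠ j}, U i) := by
    refine disjoint_iUnion₂_right.2 fun i hi => Metric.ball_disjoint_ball ?_
    have := hsep j i (Ne.symm hi)
    rw [dist_eq_norm]
    linarith
  have hsub : Metric.sphere q 1 ⊆ U j := by
    refine hconn.subset_left_of_subset_union Metric.isOpen_ball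
      (isOpen_biUnion fun _ _ => Metric.isOpen_ball) hdisj (fun c hc => ?_) ⟨c₀, hc₀, hj⟩
    obtain ⟨i, hi⟩ := hcover c hc
    by_cases hij : i = j
    · exact Or.inl (hij ▸ hi)
    · exact Or.inr (mem_iUnion₂.2 ⟨i, hij, hi⟩)
  have hpos : 0 < ‖q - p j‖ := (hA j).blockRadius_pos.trans (hq j)
  -- The point of the sphere farthest from `p j` is at distance `‖q - p j‖ + 1 > ρ_j + 1`, a
  -- contradiction.
  have hmem : q + ‖q - p j‖⁻¹ • (q - p j) ∈ Metric.sphere q 1 := by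
    rw [mem_sphere_iff_norm, add_sub_cancel_left, norm_smul, norm_inv, norm_norm,
      inv_mul_cancel₀ hpos.ne']
  have h1 := hsub hmem
  rw [Metric.mem_ball, dist_eq_norm] at h1
  have h2 : q + ‖q - p j‖⁻¹ • (q - p j) - p j = (1 + ‖q - p j‖⁻¹) • (q - p j) := by module
  rw [h2, norm_smul, Real.norm_of_nonneg (by positivity), add_mul, one_mul,
    inv_mul_cancel₀ hpos.ne'] at h1
  linarith [hq j]

theorem exists_isBubble_glued (q : EuclideanSpace ℝ (Fin (n + 1))) :
    ∃ S, IsBubble (glued n h ε p) S ∧ q ∈ S := by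
  by_cases hq : ∃ j, ‖q - p j‖ ≤ blockRadius h (ε j)
  · obtain ⟨j, hj⟩ := hq
    exact (hA j).exists_isBubble hn H (fun y hy => glued_eq_block hsep hy) hj
  · have hq' : ∀ j, blockRadius h (ε j) < ‖q - p j‖ := fun j => not_le.1 (not_exists.1 hq j)
    obtain ⟨c, hc, hcj⟩ := exists_center hA hn hsep hq'
    obtain ⟨S, hS, hSy⟩ := isBubble_unitSphere (K := glued n h ε p) (c := c) hn fun y hy =>
      glued_eq_one_of_blockRadius_le hA hn H hsep fun j => by
        have h1 : ‖c - p j‖ ≤ ‖y - c‖ + ‖y - p j‖ := by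
          rw [show c - p j = -(y - c) + (y - p j) by abel]
          exact (norm_add_le _ _).trans (by rw [norm_neg])
        linarith [hcj j]
    exact ⟨S, hS, hSy q hc⟩

omit hA hn H in
theorem periodic_glued (hε : ∀ i j, ε i = ε j) {v : EuclideanSpace ℝ (Fin (n + 1))}
    (hv : (fun q => q + v) '' range p = range p) : Function.Periodic (glued n h ε p) v := by
  intro q
  by_cases hq : ∃ j, ‖q - p j‖ ≤ blockRadius h (ε j)
  · obtain ⟨j, hj⟩ := hq
    obtain ⟨i, hi⟩ : p j + v ∈ range p := hv ▸ mem_image_of_mem _ (mem_range_self j)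
    have e : q + v - p i = q - p j := by rw [hi]; abel
    rw [glued_eq_block hsep hj, glued_eq_block hsep (j := i) (by rw [e, hε i j]; exact hj), e, hε i j]
  · have hq' := not_exists.1 hq
    rw [glued_eq_one hq', glued_eq_one fun j hj => ?_]
    -- The reverse inclusion in `hv`: every centre is a translate by `v` of a centre, so `q + v`
    -- cannot enter a ball unless `q` is in one.
    have hpj : p j ∈ (fun q => q + v) '' range p := hv.symm ▸ mem_range_self j
    obtain ⟨_, ⟨i, rfl⟩, hi⟩ := hpj
    have e : q + v - p j = q - p i := by rw [← hi]; simp only; abel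
    rw [e, hε j i] at hj
    exact hq' i hj

omit hA in
theorem tendsto_glued (hε : Tendsto ε atTop (𝓝 0)) :
    Tendsto (glued n h ε p) (cocompact (EuclideanSpace ℝ (Fin (n + 1)))) (𝓝 1) := by
  refine Metric.tendsto_nhds.2 fun η hη => ?_
  -- Only the finitely many blocks with index below `J` can deviate from 1 by `η` or more, and their
  -- balls form a compact set.
  obtain ⟨J, hJ⟩ := eventually_atTop.1 (hε.eventually (eventually_isAdmissible hn H hη))
  have hK : IsCompact (⋃ j ∈ Finset.range J, Metric.closedBall (p j) (blockRadius h (ε j))) :=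
    (Finset.range J).isCompact_biUnion fun j _ => isCompact_closedBall _ _
  filter_upwards [hK.compl_mem_cocompact] with q hq
  rw [Real.dist_eq]
  refine abs_glued_sub_one_lt hn H hη hsep fun j hj => hJ j (not_lt.1 fun hlt => hq ?_)
  exact mem_iUnion₂.2 ⟨j, Finset.mem_range.2 hlt, by rwa [Metric.mem_closedBall, dist_eq_norm]⟩

end Glued

end HBubble

theorem theorem2 (n : ℕ) (hn : 1 ≤ n) (h : ℝ → ℝ)
    (h_smooth : ContDiff ℝ ∞ h) (h_periodic : Function.Periodic h (2 * Real.pi))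
    (h_even : Function.Even h)
    (h_two_zero : iteratedDeriv 2 h 0 = 0) (h_four_zero : iteratedDeriv 4 h 0 = 0)
    (h_two_pi : iteratedDeriv 2 h Real.pi = 0) :
    ∃ ε₀ : ℝ, 0 < ε₀ ∧
      ∀ (ε : ℕ → ℝ) (p : ℕ → EuclideanSpace ℝ (Fin (n + 1))),
        (∀ j, |ε j| < ε₀) →
        (∀ i j, i ≠ j →
          HBubble.blockRadius h (ε i) + HBubble.blockRadius h (ε j) + 2 ≤ ‖p i - p j‖) →
        -- the gluing is unambiguous
        (∀ j q, ‖q - p j‖ ≤ HBubble.blockRadius h (ε j) →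
          HBubble.glued n h ε p q = HBubble.block n h (ε j) (q - p j)) ∧
        -- regularity, bounds and filling property
        ContDiff ℝ 1 (HBubble.glued n h ε p) ∧
        (∃ C₁ C₂ : ℝ, 0 < C₁ ∧ 0 < C₂ ∧
          ∀ q, C₁ ≤ HBubble.glued n h ε p q ∧ HBubble.glued n h ε p q ≤ C₂) ∧
        (∀ q, ∃ S, HBubble.IsBubble (HBubble.glued n h ε p) S ∧ q ∈ S) ∧
        -- periodicity
        ((∀ i j, ε i = ε j) →
          ∀ v : EuclideanSpace ℝ (Fin (n + 1)), (fun q => q + v) '' Set.range p = Set.range p →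
            Function.Periodic (HBubble.glued n h ε p) v) ∧
        -- behaviour at infinity
        (Filter.Tendsto ε Filter.atTop (nhds 0) →
          Filter.Tendsto (HBubble.glued n h ε p)
            (Filter.cocompact (EuclideanSpace ℝ (Fin (n + 1)))) (nhds 1)) ∧
        -- smoothness
        ((∀ᶠ t in nhds (0 : ℝ), h t = 0) → (∀ᶠ t in nhds Real.pi, h t = 0) →
          ContDiff ℝ ∞ (HBubble.glued n h ε p)) := by
  have hh : HBubble.IsSmoothEvenPeriodic h := ⟨h_smooth, h_periodic, h_even⟩
  obtain ⟨h₁, h₂, h₃, H⟩ := HBubble.exists_hasCosDerivs hh h_two_zero h_four_zero h_two_pi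
  -- Any tolerance in `(0, 1)` would keep the curvature positive; `1 / 2` gives the bounds `1 / 2`
  -- and `3 / 2`.
  obtain ⟨ε₀, hε₀, hadm⟩ := Metric.eventually_nhds_iff.1
    (HBubble.eventually_isAdmissible hn H (by norm_num : (0 : ℝ) < 1 / 2))
  refine ⟨ε₀, hε₀, fun ε p hε hsep => ?_⟩
  have hA : ∀ j, HBubble.IsAdmissible n h h₁ h₂ (1 / 2) (ε j) := fun j =>
    hadm (by rw [Real.dist_eq, sub_zero]; exact hε j)
  refine ⟨fun j q => HBubble.glued_eq_block hsep,
    HBubble.contDiff_glued hA hn H hsep fun j => (hA j).contDiff_one_block hn H,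
    ⟨1 / 2, 3 / 2, by norm_num, by norm_num, fun q => ?_⟩,
    HBubble.exists_isBubble_glued hA hn H hsep,
    fun hε' v => HBubble.periodic_glued hsep hε',
    HBubble.tendsto_glued hn H hsep,
    fun hflat _ => HBubble.contDiff_glued hA hn H hsep fun j =>
      (hA j).contDiff_infty_block hn H hflat⟩
  have := abs_lt.1 (HBubble.abs_glued_sub_one_lt hn H (by norm_num) (q := q) hsep fun j _ => hA j)
  constructor <;> linarith
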